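/- Let $T\subset\mathbb C$ be a domain, let $A_0,\dots,A_7$ be analytic functions on $T$, and consider the chain $$u^j_{n+1,x}=u^j_{n,x}+f(u^{j+1}_n,u^j_n,u^j_{n+1},u^{j-1}_{n+1}),\qquad j,n\in\mathbb Z,$$ $$f=A_0u^{j+1}_nu^j_nu^{j-1}_{n+1}+A_1u^j_nu^{j-1}_{n+1}+A_2u^{j+1}_nu^j_n+A_3u^{j+1}_nu^{j-1}_{n+1}+A_4u^{j+1}_n+A_5u^j_n+A_6u^{j-1}_{n+1}+A_7,$$ where $A_i=A_i(\tau)$, $\tau=u^j_n-u^j_{n+1}\in T$, and neither $\partial f/\partial u^{j+1}_n$ nor $\partial f/\partial u^{j-1}_{n+1}$ vanishes identically. For $N_1,N_2\ge 0$ the reduced system consists of the equations with $-N_2\le j\le N_1$, in which $u^{N_1+1}_n$ and $u^{-N_2-1}_n$ are replaced by $0$. Write $f^j_k$ for its right-hand sides. Its characteristic algebra $L_x$ in the direction of $x$ is the Lie–Rinehart algebra, over the ring of analytic functions of finitely many of the variables $u^j_k$, generated by the vector fields $X_j=\sum_{k\in\mathbb Z}\partial/\partial u^j_k$ and $$Y=\sum_{j=-N_2}^{N_1}\Big(\sum_{k\ge1}(f^j_0+\dots+f^j_{k-1})\frac{\partial}{\partial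 u^j_k}-\sum_{k\ge1}(f^j_{-1}+\dots+f^j_{-k})\frac{\partial}{\partial u^j_{-k}}\Big).$$ Its dimension is the maximal number of its elements that are linearly independent over this ring. Suppose that $\dim L_x<\infty$ for all $N_1,N_2\ge0$ (in particular, this holds if the chain is integrable in the sense that the characteristic algebras in both directions $x$ and $n$ are finite-dimensional for all $N_1,N_2\ge 0$), and that $A_0=A_1=A_2=A_3=0$ and $$A_4=c_{4,0}\tau+c_{4,1}\tau\log\tau+c_{4,2}\tau(\log\tau)^2,\quad A_6=c_{6,0}\tau+c_{6,1}\tau\log\tau+c_{6,2}\tau(\log\tau)^2,$$ $$A_5=c_5\tau,\qquad A_7=-\tfrac{c_5}{2}\tau^2+c_7\tau$$ with complex constants, for a branch of the logarithm on some nonempty open subset of $T$ (hence on all of $T$ by analytic continuation). (i) If $(c_5-c_{4,0})(c_5-c_{6,0})\ne0$, then for some integers $M,\bar M\ge1$ an invertible holomorphic point change of variables $u^j_n\mapsto\varphi^j_n(u^j_n)$ brings the chain to the form $$u^j_{n+1,x}=u^j_{n,x}+(u^j_n-u^j_{n+1})(u^j_n+u^j_{n+1}-Mu^{j+1}_n-\bar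 Mu^{j-1}_{n+1}).$$ (ii) If $(c_5-c_{4,0})(c_5-c_{6,0})=0$, then $c_5\ne0$ and such a point change brings the chain to the form $$u^j_{n+1,x}=u^j_{n,x}+(u^j_n-u^j_{n+1})(u^j_n+u^j_{n+1}+C_4u^{j+1}_n+C_6u^{j-1}_{n+1}),$$ where $C_4=2c_{4,0}/c_5$, $C_6=2c_{6,0}/c_5$, and $C_4=2$ or $C_6=2$. -/

import Mathlib

noncomputable section

namespace Chain

/-! ### Functions and vector fields in (possibly infinitely many) complex variables -/

section VectorFields

variable {ι : Type} (Ω : Set (ι → ℂ))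

/-- The ring of analytic functions on `Ω`, each of which depends on finitely many of the
variables only. -/
def analyticRing : Subalgebra ℂ (Ω → ℂ) where
  carrier := {g | ∃ (s : Finset ι) (G : (s → ℂ) → ℂ), ∀ u : Ω,
    AnalyticAt ℂ G (fun i => u.1 i) ∧ g u = G (fun i => u.1 i)}
  mul_mem' := by
    classical
    rintro a b ⟨s, G, hG⟩ ⟨t, H, hH⟩
    refine ⟨s ∪ t, fun v => G (fun i => v ⟨i.1, Finset.mem_union_left _ i.2⟩) *
      H (fun i => v ⟨i.1, Finset.mem_union_right _ i.2⟩), fun u => ⟨?_, ?_⟩⟩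
    · refine AnalyticAt.mul ?_ ?_
      · exact AnalyticAt.fun_comp (g := G)
          (f := fun v : ((s ∪ t : Finset ι) → ℂ) => fun i : s =>
            v ⟨i.1, Finset.mem_union_left _ i.2⟩)
          (hG u).1 (AnalyticAt.pi fun i =>
            (ContinuousLinearMap.proj (R := ℂ) (φ := fun _ : (s ∪ t : Finset ι) => ℂ)
              ⟨i.1, Finset.mem_union_left _ i.2⟩).analyticAt _)
      · exact AnalyticAt.fun_comp (g := H)
          (f := fun v : ((s ∪ t : Finset ι) → ℂ) => fun i : t =>
            v ⟨i.1, Finset.mem_union_right _ i.2⟩)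
          (hH u).1 (AnalyticAt.pi fun i =>
            (ContinuousLinearMap.proj (R := ℂ) (φ := fun _ : (s ∪ t : Finset ι) => ℂ)
              ⟨i.1, Finset.mem_union_right _ i.2⟩).analyticAt _)
    · simp [(hG u).2, (hH u).2]
  add_mem' := by
    classical
    rintro a b ⟨s, G, hG⟩ ⟨t, H, hH⟩
    refine ⟨s ∪ t, fun v => G (fun i => v ⟨i.1, Finset.mem_union_left _ i.2⟩) +
      H (fun i => v ⟨i.1, Finset.mem_union_right _ i.2⟩), fun u => ⟨?_, ?_⟩⟩
    · refine AnalyticAt.add ?_ ?_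
      · exact AnalyticAt.fun_comp (g := G)
          (f := fun v : ((s ∪ t : Finset ι) → ℂ) => fun i : s =>
            v ⟨i.1, Finset.mem_union_left _ i.2⟩)
          (hG u).1 (AnalyticAt.pi fun i =>
            (ContinuousLinearMap.proj (R := ℂ) (φ := fun _ : (s ∪ t : Finset ι) => ℂ)
              ⟨i.1, Finset.mem_union_left _ i.2⟩).analyticAt _)
      · exact AnalyticAt.fun_comp (g := H)
          (f := fun v : ((s ∪ t : Finset ι) → ℂ) => fun i : t =>
            v ⟨i.1, Finset.mem_union_right _ i.2⟩)
          (hH u).1 (AnalyticAt.pi fun i =>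
            (ContinuousLinearMap.proj (R := ℂ) (φ := fun _ : (s ∪ t : Finset ι) => ℂ)
              ⟨i.1, Finset.mem_union_right _ i.2⟩).analyticAt _)
    · simp [(hG u).2, (hH u).2]
  algebraMap_mem' := fun r => ⟨∅, fun _ => r, fun _ => ⟨analyticAt_const, rfl⟩⟩

/-- A formal vector field `∑ᵢ Zᵢ ∂/∂uᵢ` on `Ω` (an infinite sum is allowed), given by its
coefficients. -/
abbrev VField : Type := ι → Ω → ℂ

variable {Ω}

open Classical in
/-- The partial derivative `∂g/∂uᵢ` of a function on `Ω`. -/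
def pderiv (i : ι) (g : Ω → ℂ) (u : Ω) : ℂ :=
  deriv (fun t : ℂ => if h : Function.update u.1 i t ∈ Ω then g ⟨Function.update u.1 i t, h⟩
    else 0) (u.1 i)

/-- The derivative `Z(g) = ∑ᵢ Zᵢ ∂g/∂uᵢ`; the sum is finite when `g` depends on finitely many
variables. -/
def VField.act (Z : VField Ω) (g : Ω → ℂ) : Ω → ℂ :=
  fun u => ∑ᶠ i, Z i u * pderiv i g u

/-- The commutator `[Z, W]` of two vector fields. -/
def VField.bracket (Z W : VField Ω) : VField Ω :=
  fun i => Z.act (W i) - W.act (Z i)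

variable (Ω) in
/-- The Lie–Rinehart algebra over the ring of analytic functions generated by a set of vector
fields: the smallest module over this ring which contains the generators and is closed under
commutators. -/
def lieRinehartSpan (S : Set (VField Ω)) : Submodule (analyticRing Ω) (VField Ω) :=
  sInf {L | S ⊆ L ∧ ∀ Z ∈ L, ∀ W ∈ L, VField.bracket Z W ∈ L}

end VectorFields

/-! ### The chain and its reductions -/

/-- The right-hand side `f(u^{j+1}_n, u^j_n, u^j_{n+1}, u^{j-1}_{n+1})`, whose arguments are in
this order `a, b, c, d`; the coefficients `A₀, …, A₇` depend on `τ = b - c`. -/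
def rhs (A : Fin 8 → ℂ → ℂ) (a b c d : ℂ) : ℂ :=
  A 0 (b - c) * a * b * d + A 1 (b - c) * b * d + A 2 (b - c) * a * b + A 3 (b - c) * a * d
    + A 4 (b - c) * a + A 5 (b - c) * b + A 6 (b - c) * d + A 7 (b - c)

section Reduction

variable (N₁ N₂ : ℕ)

/-- The dynamical variables `u^j_k`, `-N₂ ≤ j ≤ N₁`, `k ∈ ℤ`, of the reduced system. -/
abbrev Var : Type := Set.Icc (-(N₂ : ℤ)) (N₁ : ℤ) × ℤ

/-- The value `u^j_k`, with the cut-off conditions `u^j_k = 0` for `j > N₁` and `j < -N₂`. -/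
def cutoff (u : Var N₁ N₂ → ℂ) (j k : ℤ) : ℂ :=
  if h : j ∈ Set.Icc (-(N₂ : ℤ)) (N₁ : ℤ) then u (⟨j, h⟩, k) else 0

/-- The domain of the dynamical variables: all differences `u^j_k - u^j_{k+1}` lie in the domain
`T` of the coefficients. -/
def phaseSpace (T : Set ℂ) : Set (Var N₁ N₂ → ℂ) :=
  {u | ∀ j k, u (j, k) - u (j, k + 1) ∈ T}

/-- The right-hand side `f^j_k` of the reduced system `u^j_{k+1,x} = u^j_{k,x} + f^j_k`. -/
def reducedRhs (A : Fin 8 → ℂ → ℂ) (u : Var N₁ N₂ → ℂ) (j k : ℤ) : ℂ :=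
  rhs A (cutoff N₁ N₂ u (j + 1) k) (cutoff N₁ N₂ u j k) (cutoff N₁ N₂ u j (k + 1))
    (cutoff N₁ N₂ u (j - 1) (k + 1))

/-- `X_j = ∑_k ∂/∂u^j_k`. -/
def fieldX (T : Set ℂ) (j : Set.Icc (-(N₂ : ℤ)) (N₁ : ℤ)) : VField (phaseSpace N₁ N₂ T) :=
  fun i _ => if i.1 = j then 1 else 0

/-- `Y`, whose coefficient at `∂/∂u^j_k` is `f^j_0 + ⋯ + f^j_{k-1}` for `k ≥ 0` and
`-(f^j_{-1} + ⋯ + f^j_k)` for `k < 0`. -/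
def fieldY (T : Set ℂ) (A : Fin 8 → ℂ → ℂ) : VField (phaseSpace N₁ N₂ T) :=
  fun i u => ∑ m ∈ Finset.Ico 0 i.2, reducedRhs N₁ N₂ A u.1 i.1 m
    - ∑ m ∈ Finset.Ico i.2 0, reducedRhs N₁ N₂ A u.1 i.1 m

/-- The characteristic algebra `L_x` of the reduced system in the direction of `x`. -/
def charAlgebraX (T : Set ℂ) (A : Fin 8 → ℂ → ℂ) :
    Submodule (analyticRing (phaseSpace N₁ N₂ T)) (VField (phaseSpace N₁ N₂ T)) :=
  lieRinehartSpan (phaseSpace N₁ N₂ T) (insert (fieldY N₁ N₂ T A) (Set.range (fieldX N₁ N₂ T)))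

end Reduction

/-- All the characteristic algebras in the direction of `x` are finite-dimensional: for all
`N₁, N₂ ≥ 0` the number of elements of `L_x` that are linearly independent over the ring of
analytic functions is bounded. -/
def FiniteXAlgebras (T : Set ℂ) (A : Fin 8 → ℂ → ℂ) : Prop :=
  ∀ N₁ N₂ : ℕ,
    Module.rank (analyticRing (phaseSpace N₁ N₂ T)) (charAlgebraX N₁ N₂ T A) < Cardinal.aleph0

/-- The function `f` depends on its first argument `u^{j+1}_n` and on its last argument
`u^{j-1}_{n+1}`: neither partial derivative vanishes identically. -/
def Nondegenerate (T : Set ℂ) (A : Fin 8 → ℂ → ℂ) : Prop :=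
  (∃ a b c d : ℂ, b - c ∈ T ∧ deriv (fun z => rhs A z b c d) a ≠ 0) ∧
  (∃ a b c d : ℂ, b - c ∈ T ∧ deriv (fun z => rhs A a b c z) d ≠ 0)

/-- The class of chains with `A₀ = A₁ = A₂ = A₃ = 0`,
`A₄ = c₄₀ τ + c₄₁ τ log τ + c₄₂ τ (log τ)²`, `A₅ = c₅ τ`,
`A₆ = c₆₀ τ + c₆₁ τ log τ + c₆₂ τ (log τ)²`, `A₇ = -(c₅/2) τ² + c₇ τ`.
The formulas are required on a nonempty open part `V` of the domain `T`, for a branch `ℓ` of the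
logarithm on `V`; on a connected `T` they persist by analytic continuation. In this way `T` may
contain `0` when no logarithms occur. -/
def IsClassOne (T : Set ℂ) (A : Fin 8 → ℂ → ℂ) (c₄₀ c₄₁ c₄₂ c₆₀ c₆₁ c₆₂ c₅ c₇ : ℂ) : Prop :=
  ∃ (V : Set ℂ) (ℓ : ℂ → ℂ), V ⊆ T ∧ IsOpen V ∧ V.Nonempty ∧ ContinuousOn ℓ V ∧
    ∀ τ ∈ V, Complex.exp (ℓ τ) = τ ∧
      A 0 τ = 0 ∧ A 1 τ = 0 ∧ A 2 τ = 0 ∧ A 3 τ = 0 ∧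
      A 4 τ = c₄₀ * τ + c₄₁ * τ * ℓ τ + c₄₂ * τ * ℓ τ ^ 2 ∧
      A 5 τ = c₅ * τ ∧
      A 6 τ = c₆₀ * τ + c₆₁ * τ * ℓ τ + c₆₂ * τ * ℓ τ ^ 2 ∧
      A 7 τ = -(c₅ / 2) * τ ^ 2 + c₇ * τ

/-! ### Point changes of variables -/

/-- A point change of variables `v^j_n = φ^j_n(u^j_n)`: an invertible holomorphic function of the
dependent variable for each `j` and `n`. -/
structure PointChange where
  /-- `map j n` is `φ^j_n`. -/
  map : ℤ → ℤ → ℂ ≃ ℂ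
  differentiable_map : ∀ j n, Differentiable ℂ (map j n)
  differentiable_symm : ∀ j n, Differentiable ℂ (map j n).symm

/-- The point change `v^j_n = φ^j_n(u^j_n)`, with `v^j_{n,x} = (φ^j_n)'(u^j_n) u^j_{n,x}`, brings
the chain `u^j_{n+1,x} = u^j_{n,x} + f(u^{j+1}_n, u^j_n, u^j_{n+1}, u^{j-1}_{n+1})`,
`u^j_n - u^j_{n+1} ∈ T`, to `v^j_{n+1,x} = v^j_{n,x} + g(v^{j+1}_n, v^j_n, v^j_{n+1}, v^{j-1}_{n+1})`:
the two equations are equivalent at all values `a, b, c, d` of the variables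
and `p, q` of the derivatives `u^j_{n,x}, u^j_{n+1,x}`. -/
def PointChange.Brings (φ : PointChange) (T : Set ℂ) (f g : ℂ → ℂ → ℂ → ℂ → ℂ) : Prop :=
  ∀ (j n : ℤ) (a b c d p q : ℂ), b - c ∈ T →
    (q = p + f a b c d ↔
      deriv (φ.map j (n + 1)) c * q = deriv (φ.map j n) b * p +
        g (φ.map (j + 1) n a) (φ.map j n b) (φ.map j (n + 1) c) (φ.map (j - 1) (n + 1) d))

end Chain

end

noncomputable section

namespace Chain

open Filter Topology

/-! ### Derivations and commutators on functions of finitely many variables -/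

section Calculus

variable {ι : Type} {Ω : Set (ι → ℂ)}

/-! Only the reduction N₁ = 1, N₂ = 0 is needed. Let a, b be its two components in either order
(`IsPair`), let Ba, Bb be the coefficients of their coupling terms, and let Z = [X_b, Y]. Infinite
rank is always detected by `not_rank_lt_aleph0`: a ring coefficient sees finitely many variables, so
freezing these turns a linear relation into one with constant coefficients, which is then tested by
moving variables far out.

Logarithms (`IsPair.natDegree_eq_zero`). On a difference τ of neighbouring variables u^a, Z acts as
-Ba(τ) d/dτ. Hence (ad Z)^s Y involves the iterates κ_i of this derivation on τ for i ≤ s, the last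
one with coefficient Bb. If Ba = τ H(log τ), then κ_i = τ P_i(log τ) with deg P_i = i deg H. For deg
H ≥ 1 these are independent and the algebra is infinite-dimensional. So H is constant, and by
symmetry Ba = κa τ, Bb = κb τ.

Integrality (`IsPair.exists_nat`). Now Y splits into parts on which ad Z is 0, -c₅ or -κa, and D =
ad Z (ad Z + c₅) Y keeps only the last part, with the factor κa(κa - c₅). The a-components of (ad
D)^{n+1} Y contain polynomials of degree n + 2 whose p^{n+2}-coefficient is, up to a nonzero factor,
the product of κb + i c₅/2 over 1 ≤ i ≤ n + 1. If no factor ever vanishes, the dimension is again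
infinite; hence κb = -i c₅/2 for some i ≥ 1. Exchanging a and b treats the other coefficient.

An affine change (`exists_brings`) then gives the normal form. It needs c₅ ≠ 0, which follows in
both cases because neither coupling coefficient vanishes. -/

/-- The coordinate function `uᵢ` on `Ω`. -/
def coord (Ω : Set (ι → ℂ)) (i : ι) : Ω → ℂ := fun u => u.1 i

lemma coord_mem (i : ι) : coord Ω i ∈ analyticRing Ω :=
  ⟨{i}, fun v => v ⟨i, Finset.mem_singleton_self i⟩, fun _ =>
    ⟨(ContinuousLinearMap.proj (R := ℂ) (φ := fun _ : ({i} : Finset ι) => ℂ)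
      ⟨i, Finset.mem_singleton_self i⟩).analyticAt _, rfl⟩⟩

lemma const_mem (c : ℂ) : (fun _ : Ω => c) ∈ analyticRing Ω :=
  (analyticRing Ω).algebraMap_mem c

lemma comp_mem {g : Ω → ℂ} (hg : g ∈ analyticRing Ω) {T : Set ℂ} {B : ℂ → ℂ}
    (hB : AnalyticOnNhd ℂ B T) (hT : ∀ u, g u ∈ T) :
    (fun u => B (g u)) ∈ analyticRing Ω := by
  obtain ⟨s, G, hG⟩ := hg
  refine ⟨s, fun v => B (G v), fun u => ⟨?_, by simp only [(hG u).2]⟩⟩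
  have h := hB _ (hT u)
  rw [(hG u).2] at h
  exact AnalyticAt.fun_comp h (hG u).1

open Classical in
/-- The set `Ω` is open in the direction of each coordinate. -/
def CoordOpen (Ω : Set (ι → ℂ)) : Prop :=
  ∀ u ∈ Ω, ∀ i, ∀ᶠ t in 𝓝 (u i), Function.update u i t ∈ Ω

open Classical in
/-- The restriction of `g` to the line through `u` in the direction of the coordinate `i`. -/
def lineFn (i : ι) (g : Ω → ℂ) (u : Ω) (t : ℂ) : ℂ :=
  if h : Function.update u.1 i t ∈ Ω then g ⟨Function.update u.1 i t, h⟩ else 0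

lemma pderiv_eq_deriv_lineFn (i : ι) (g : Ω → ℂ) (u : Ω) :
    pderiv i g u = deriv (lineFn i g u) (u.1 i) := rfl

lemma lineFn_self (i : ι) (g : Ω → ℂ) (u : Ω) : lineFn i g u (u.1 i) = g u := by
  classical
  have h : Function.update u.1 i (u.1 i) = u.1 := Function.update_eq_self _ _
  unfold lineFn
  rw [dif_pos (by convert u.2)]
  congr 1
  exact Subtype.ext (by convert h)

lemma lineFn_add (i : ι) (g h : Ω → ℂ) (u : Ω) :
    lineFn i (g + h) u = lineFn i g u + lineFn i h u := by
  ext t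
  by_cases ht : Function.update u.1 i t ∈ Ω <;> simp [lineFn, ht]

lemma lineFn_mul (i : ι) (g h : Ω → ℂ) (u : Ω) :
    lineFn i (g * h) u = lineFn i g u * lineFn i h u := by
  ext t
  by_cases ht : Function.update u.1 i t ∈ Ω <;> simp [lineFn, ht]

open Classical in
lemma hasDerivAt_lineFn (hΩ : CoordOpen Ω) {g : Ω → ℂ} (hg : g ∈ analyticRing Ω) (i : ι) (u : Ω) :
    HasDerivAt (lineFn i g u) (pderiv i g u) (u.1 i) := by
  obtain ⟨s, G, hG⟩ := hg
  have hd : DifferentiableAt ℂ (fun t : ℂ => G fun k : s => Function.update u.1 i t k)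
      (u.1 i) := by
    have h1 : DifferentiableAt ℂ G (fun k : s => Function.update u.1 i (u.1 i) k) := by
      rw [Function.update_eq_self]
      exact (hG u).1.differentiableAt
    refine DifferentiableAt.comp (u.1 i) (g := G)
      (f := fun t => fun k : s => Function.update u.1 i t k) h1 ?_
    refine differentiableAt_pi.2 fun k => ?_
    by_cases hk : (k : ι) = i
    · simp [hk]
    · simp [hk]
  have he : lineFn i g u =ᶠ[𝓝 (u.1 i)] fun t : ℂ => G fun k : s => Function.update u.1 i t k := by
    filter_upwards [hΩ u.1 u.2 i] with t ht
    rw [lineFn, dif_pos ht, (hG _).2]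
  exact (hd.congr_of_eventuallyEq he).hasDerivAt

lemma pderiv_add (hΩ : CoordOpen Ω) {g h : Ω → ℂ} (hg : g ∈ analyticRing Ω)
    (hh : h ∈ analyticRing Ω) (i : ι) (u : Ω) :
    pderiv i (g + h) u = pderiv i g u + pderiv i h u := by
  rw [pderiv_eq_deriv_lineFn, lineFn_add]
  exact ((hasDerivAt_lineFn hΩ hg i u).add (hasDerivAt_lineFn hΩ hh i u)).deriv

lemma pderiv_mul (hΩ : CoordOpen Ω) {g h : Ω → ℂ} (hg : g ∈ analyticRing Ω)
    (hh : h ∈ analyticRing Ω) (i : ι) (u : Ω) :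
    pderiv i (g * h) u = pderiv i g u * h u + g u * pderiv i h u := by
  rw [pderiv_eq_deriv_lineFn, lineFn_mul]
  have := ((hasDerivAt_lineFn hΩ hg i u).mul (hasDerivAt_lineFn hΩ hh i u)).deriv
  rwa [lineFn_self, lineFn_self] at this

lemma pderiv_comp (hΩ : CoordOpen Ω) {g : Ω → ℂ} (hg : g ∈ analyticRing Ω) {B : ℂ → ℂ}
    (i : ι) (u : Ω) (hB : DifferentiableAt ℂ B (g u)) :
    pderiv i (fun v => B (g v)) u = deriv B (g u) * pderiv i g u := by
  have h1 : HasDerivAt B (deriv B (g u)) (lineFn i g u (u.1 i)) := by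
    rw [lineFn_self]; exact hB.hasDerivAt
  have h2 := (h1.comp _ (hasDerivAt_lineFn hΩ hg i u))
  have he : lineFn i (fun v => B (g v)) u =ᶠ[𝓝 (u.1 i)] B ∘ lineFn i g u := by
    filter_upwards [hΩ u.1 u.2 i] with t ht
    simp [lineFn, ht]
  rw [pderiv_eq_deriv_lineFn, he.deriv_eq, h2.deriv]

open Classical in
lemma pderiv_coord (hΩ : CoordOpen Ω) (i j : ι) (u : Ω) :
    pderiv i (coord Ω j) u = if i = j then 1 else 0 := by
  have he : lineFn i (coord Ω j) u =ᶠ[𝓝 (u.1 i)] fun t => Function.update u.1 i t j := by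
    filter_upwards [hΩ u.1 u.2 i] with t ht
    simp [lineFn, ht, coord]
  rw [pderiv_eq_deriv_lineFn, he.deriv_eq]
  by_cases h : i = j
  · subst h; simp
  · simp [h, Ne.symm h]

/-- This replaces the `finsum` in `VField.act` by a sum over a finite set, which can be enlarged to
serve several functions at once; the derivation rules then hold term by term. -/
lemma exists_finset_pderiv_eq_zero (hΩ : CoordOpen Ω) {g : Ω → ℂ} (hg : g ∈ analyticRing Ω) :
    ∃ s : Finset ι, ∀ i ∉ s, ∀ u, pderiv i g u = 0 := by
  classical
  obtain ⟨s, G, hG⟩ := hg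
  refine ⟨s, fun i hi u => ?_⟩
  have he : lineFn i g u =ᶠ[𝓝 (u.1 i)] fun _ => g u := by
    filter_upwards [hΩ u.1 u.2 i] with t ht
    rw [lineFn, dif_pos (by convert ht), (hG _).2, (hG _).2]
    congr 1
    ext k
    have : (k : ι) ≠ i := fun h => hi (h ▸ k.2)
    simp [this]
  rw [pderiv_eq_deriv_lineFn, he.deriv_eq, deriv_const]

lemma act_eq_sum {s : Finset ι} {g : Ω → ℂ} {u : Ω} (hs : ∀ i ∉ s, pderiv i g u = 0)
    (Z : VField Ω) : Z.act g u = ∑ i ∈ s, Z i u * pderiv i g u := by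
  refine finsum_eq_sum_of_support_subset _ fun i hi => ?_
  by_contra h
  exact hi (by simp [hs i h])

/-- The function `g` is analytic, depends on finitely many variables, and `Z(g) = g'`. -/
structure HasAct (Z : VField Ω) (g g' : Ω → ℂ) : Prop where
  mem : g ∈ analyticRing Ω
  act_eq : Z.act g = g'

namespace HasAct

variable {Z : VField Ω} {g g' h h' : Ω → ℂ}

lemma congr {k k' : Ω → ℂ} (H : HasAct Z g g') (h1 : g = k) (h2 : g' = k') : HasAct Z k k' :=
  h1 ▸ h2 ▸ H

lemma add (hΩ : CoordOpen Ω) (H : HasAct Z g g') (K : HasAct Z h h') :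
    HasAct Z (fun u => g u + h u) (fun u => g' u + h' u) := by
  classical
  refine ⟨add_mem H.mem K.mem, ?_⟩
  obtain ⟨s, hs⟩ := exists_finset_pderiv_eq_zero hΩ H.mem
  obtain ⟨t, ht⟩ := exists_finset_pderiv_eq_zero hΩ K.mem
  ext u
  have e : (fun u => g u + h u) = g + h := rfl
  rw [e, ← H.act_eq, ← K.act_eq,
    act_eq_sum (s := s ∪ t) (fun i hi => by
      rw [pderiv_add hΩ H.mem K.mem, hs i (by grind), ht i (by grind), add_zero]),
    act_eq_sum (s := s ∪ t) (fun i hi => hs i (by grind) u),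
    act_eq_sum (s := s ∪ t) (fun i hi => ht i (by grind) u), ← Finset.sum_add_distrib]
  exact Finset.sum_congr rfl fun i _ => by rw [pderiv_add hΩ H.mem K.mem, mul_add]

lemma mul (hΩ : CoordOpen Ω) (H : HasAct Z g g') (K : HasAct Z h h') :
    HasAct Z (fun u => g u * h u) (fun u => g' u * h u + g u * h' u) := by
  classical
  refine ⟨mul_mem H.mem K.mem, ?_⟩
  obtain ⟨s, hs⟩ := exists_finset_pderiv_eq_zero hΩ H.mem
  obtain ⟨t, ht⟩ := exists_finset_pderiv_eq_zero hΩ K.mem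
  ext u
  have e : (fun u => g u * h u) = g * h := rfl
  rw [e, ← H.act_eq, ← K.act_eq,
    act_eq_sum (s := s ∪ t) (fun i hi => by
      rw [pderiv_mul hΩ H.mem K.mem, hs i (by grind), ht i (by grind), zero_mul, mul_zero,
        add_zero]),
    act_eq_sum (s := s ∪ t) (fun i hi => hs i (by grind) u),
    act_eq_sum (s := s ∪ t) (fun i hi => ht i (by grind) u), Finset.sum_mul, Finset.mul_sum,
    ← Finset.sum_add_distrib]
  exact Finset.sum_congr rfl fun i _ => by rw [pderiv_mul hΩ H.mem K.mem]; ring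

lemma comp (hΩ : CoordOpen Ω) (H : HasAct Z g g') {T : Set ℂ} {B : ℂ → ℂ}
    (hB : AnalyticOnNhd ℂ B T) (hT : ∀ u, g u ∈ T) :
    HasAct Z (fun u => B (g u)) (fun u => deriv B (g u) * g' u) := by
  refine ⟨comp_mem H.mem hB hT, ?_⟩
  obtain ⟨s, hs⟩ := exists_finset_pderiv_eq_zero hΩ H.mem
  ext u
  have hd := fun i => pderiv_comp hΩ H.mem i u (hB _ (hT u)).differentiableAt
  rw [← H.act_eq, act_eq_sum (s := s) (fun i hi => by rw [hd, hs i hi, mul_zero]),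
    act_eq_sum (s := s) (fun i hi => hs i hi u), Finset.mul_sum]
  exact Finset.sum_congr rfl fun i _ => by rw [hd]; ring

lemma const (c : ℂ) : HasAct Z (fun _ => c) (fun _ => 0) := by
  refine ⟨const_mem c, ?_⟩
  ext u
  have h : ∀ i, pderiv i (fun _ : Ω => c) u = 0 := by
    intro i
    by_cases hc : ∀ᶠ t in 𝓝 (u.1 i), lineFn i (fun _ : Ω => c) u t = c
    · rw [pderiv_eq_deriv_lineFn, EventuallyEq.deriv_eq (f := fun _ => c) hc, deriv_const]
    · rw [pderiv_eq_deriv_lineFn]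
      -- No openness of Ω is assumed here. Off Ω the line function is 0, so for c ≠ 0
      -- differentiability would force it to stay nonzero, hence equal to c, near the point;
      -- otherwise `deriv` takes its default value 0.
      refine deriv_zero_of_not_differentiableAt fun hd => hc ?_
      by_cases c0 : c = 0
      · subst c0
        exact Eventually.of_forall fun t => by simp [lineFn]
      · have := hd.continuousAt.eventually_ne (y := 0) (by rw [lineFn_self]; exact c0)
        filter_upwards [this] with t ht
        unfold lineFn at ht ⊢
        split_ifs at ht ⊢ <;> simp_all
  rw [act_eq_sum (s := ∅) fun i _ => h i]
  simp

lemma coord (hΩ : CoordOpen Ω) (i : ι) : HasAct Z (coord Ω i) (Z i) := by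
  classical
  refine ⟨coord_mem i, ?_⟩
  ext u
  rw [act_eq_sum (s := {i}) fun k hk => by
    rw [pderiv_coord hΩ, if_neg (by simpa using hk)]]
  simp [pderiv_coord hΩ]

lemma const_mul (hΩ : CoordOpen Ω) (c : ℂ) (H : HasAct Z g g') :
    HasAct Z (fun u => c * g u) (fun u => c * g' u) :=
  ((const c).mul hΩ H).congr rfl (by ext; simp)

lemma neg (hΩ : CoordOpen Ω) (H : HasAct Z g g') :
    HasAct Z (fun u => -g u) (fun u => -g' u) :=
  (H.const_mul hΩ (-1)).congr (by ext; simp) (by ext; simp)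

lemma sub (hΩ : CoordOpen Ω) (H : HasAct Z g g') (K : HasAct Z h h') :
    HasAct Z (fun u => g u - h u) (fun u => g' u - h' u) :=
  (H.add hΩ (K.neg hΩ)).congr (by ext; simp [sub_eq_add_neg]) (by ext; simp [sub_eq_add_neg])

lemma pow (hΩ : CoordOpen Ω) (H : HasAct Z g g') (n : ℕ) :
    HasAct Z (fun u => g u ^ n) (fun u => n * g u ^ (n - 1) * g' u) := by
  induction n with
  | zero => exact (const 1).congr (by ext; simp) (by ext; simp)
  | succ n ih =>
    refine (ih.mul hΩ H).congr (by ext; simp [pow_succ]) ?_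
    ext u
    rcases n with _ | n
    · simp
    · simp; ring

lemma sum (hΩ : CoordOpen Ω) {α : Type*} (s : Finset α) {G G' : α → Ω → ℂ}
    (H : ∀ a ∈ s, HasAct Z (G a) (G' a)) :
    HasAct Z (fun u => ∑ a ∈ s, G a u) (fun u => ∑ a ∈ s, G' a u) := by
  classical
  induction s using Finset.induction_on with
  | empty => exact (const 0).congr (by ext; simp) (by ext; simp)
  | insert a s ha ih =>
    refine ((H a (by simp)).add hΩ (ih fun b hb => H b (by simp [hb]))).congr ?_ ?_ <;>
      ext <;> simp [ha]

end HasAct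

lemma bracket_apply {Z W : VField Ω} {i : ι} {g h : Ω → ℂ} (H : HasAct Z (W i) g)
    (K : HasAct W (Z i) h) (u : Ω) : VField.bracket Z W i u = g u - h u := by
  rw [VField.bracket, Pi.sub_apply, H.act_eq, K.act_eq]

/-- The iterated commutator `(ad Z)ˢ W`. -/
def adIter (Z W : VField Ω) : ℕ → VField Ω
  | 0 => W
  | s + 1 => VField.bracket Z (adIter Z W s)

lemma bracket_mem_lieRinehartSpan {S : Set (VField Ω)} {Z W : VField Ω}
    (hZ : Z ∈ lieRinehartSpan Ω S) (hW : W ∈ lieRinehartSpan Ω S) :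
    VField.bracket Z W ∈ lieRinehartSpan Ω S := by
  rw [lieRinehartSpan, Submodule.mem_sInf] at *
  exact fun L hL => hL.2 Z (hZ L hL) W (hW L hL)

lemma subset_lieRinehartSpan (S : Set (VField Ω)) : S ⊆ lieRinehartSpan Ω S := by
  intro Z hZ
  rw [lieRinehartSpan, SetLike.mem_coe, Submodule.mem_sInf]
  exact fun L hL => hL.1 hZ

lemma adIter_mem_lieRinehartSpan {S : Set (VField Ω)} {Z W : VField Ω}
    (hZ : Z ∈ lieRinehartSpan Ω S) (hW : W ∈ lieRinehartSpan Ω S) (s : ℕ) :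
    adIter Z W s ∈ lieRinehartSpan Ω S := by
  induction s with
  | zero => exact hW
  | succ s ih => exact bracket_mem_lieRinehartSpan hZ ih

lemma const_smul_mem (L : Submodule (analyticRing Ω) (VField Ω)) (c : ℂ) {Z : VField Ω}
    (hZ : Z ∈ L) : (fun i u => c * Z i u : VField Ω) ∈ L :=
  L.smul_mem (⟨fun _ => c, const_mem c⟩ : analyticRing Ω) hZ

lemma not_rank_lt_aleph0_of_forall_sum {R M : Type*} [CommRing R] [Nontrivial R] [AddCommGroup M]
    [Module R M] (L : Submodule R M) (W : ℕ → M) (hW : ∀ s, W s ∈ L)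
    (hind : ∀ (t : Finset ℕ) (g : ℕ → R), ∑ s ∈ t, g s • W s = 0 → ∀ s ∈ t, g s = 0) :
    ¬ Module.rank R L < Cardinal.aleph0 := by
  intro hlt
  have hli : LinearIndependent R (fun s => (⟨W s, hW s⟩ : L)) := by
    refine linearIndependent_iff'.2 fun t g hg => hind t g ?_
    simpa using congrArg Subtype.val hg
  have := hli.cardinal_lift_le_rank
  simp at this
  exact absurd hlt (not_lt.2 this)

/-- Vector fields are linearly independent over the ring of analytic functions if at each point,
even after freezing finitely many variables, they satisfy no linear relation with constant
coefficients. -/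
lemma not_rank_lt_aleph0 [Nonempty Ω] (L : Submodule (analyticRing Ω) (VField Ω))
    (W : ℕ → VField Ω) (hW : ∀ s, W s ∈ L)
    (hind : ∀ (u : Ω) (F : Finset ι) (γ : ℕ → ℂ) (t : Finset ℕ),
      (∀ u' : Ω, (∀ i ∈ F, u'.1 i = u.1 i) → ∀ i, ∑ s ∈ t, γ s * W s i u' = 0) →
        ∀ s ∈ t, γ s = 0) :
    ¬ Module.rank (analyticRing Ω) L < Cardinal.aleph0 := by
  classical
  refine not_rank_lt_aleph0_of_forall_sum L W hW fun t g hg s hs => ?_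
  have hg' : ∀ i u, ∑ s ∈ t, (g s).1 u * W s i u = 0 := by
    intro i u
    have := congrArg (fun w : VField Ω => w i u) hg
    simp only [Finset.sum_apply, Pi.zero_apply] at this
    exact this
  choose F G hG using fun s => (g s).2
  apply Subtype.ext
  ext u
  -- With all variables that occur in the coefficients frozen at u, each coefficient keeps its value
  -- at u and acts as a constant.
  refine hind u (t.biUnion F) (fun s => (g s).1 u) t (fun u' hu' i => ?_) s hs
  rw [← hg' i u']
  refine Finset.sum_congr rfl fun s hs => ?_
  rw [(hG s u).2, (hG s u').2]
  congr 2
  ext k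
  exact (hu' k (Finset.mem_biUnion.2 ⟨s, hs, k.2⟩)).symm

end Calculus

/-! ### The reduced system with two components -/

section TwoComponents

/-- The upper indices of the reduced system with `N₁ = 1`, `N₂ = 0`. -/
abbrev Comp : Type := Set.Icc (-((0 : ℕ) : ℤ)) ((1 : ℕ) : ℤ)

/-- A single variable enters only two of the differences constrained to T, so although the phase
space imposes infinitely many conditions, only two open ones matter. -/
lemma coordOpen_phaseSpace {N₁ N₂ : ℕ} {T : Set ℂ} (hT : IsOpen T) :
    CoordOpen (phaseSpace N₁ N₂ T) := by
  classical
  rintro u hu ⟨j, k⟩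
  have h1 : ∀ᶠ t in 𝓝 (u (j, k)), t - u (j, k + 1) ∈ T :=
    (continuousAt_id.sub continuousAt_const).eventually_mem (hT.mem_nhds (hu j k))
  have h2 : ∀ᶠ t in 𝓝 (u (j, k)), u (j, k - 1) - t ∈ T := by
    refine (continuousAt_const.sub continuousAt_id).eventually_mem (hT.mem_nhds ?_)
    have := hu j (k - 1)
    simpa using this
  filter_upwards [h1, h2] with t ht1 ht2 j' k'
  simp only [Function.update_apply, Prod.mk.injEq]
  by_cases hj : j' = j
  · subst hj
    by_cases hk : k' = k
    · subst hk; simpa using ht1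
    · by_cases hk' : k' + 1 = k
      · subst hk'; simpa using ht2
      · simpa [hk, hk'] using hu j' k'
  · simpa [hj] using hu j' k'

variable (T : Set ℂ)

/-- The variable `u^j_k` as a function on the phase space. -/
def cv (j : Comp) (k : ℕ) : phaseSpace 1 0 T → ℂ := fun u => u.1 (j, (k : ℤ))

/-- The difference `u^j_k - u^j_{k+1}` as a function on the phase space. -/
def dv (j : Comp) (k : ℕ) : phaseSpace 1 0 T → ℂ := fun u => cv T j k u - cv T j (k + 1) u

lemma dv_mem (j : Comp) (k : ℕ) (u : phaseSpace 1 0 T) : dv T j k u ∈ T := by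
  have := u.2 j k
  simpa [dv, cv] using this

lemma sum_dv (j : Comp) (k : ℕ) (u : phaseSpace 1 0 T) :
    ∑ l ∈ Finset.range k, dv T j l u = cv T j 0 u - cv T j k u :=
  Finset.sum_range_sub' (fun l => cv T j l u) k

/-- The right-hand side of the equation for the component `b`, which is coupled to the
component `a` with the shift `ε`. -/
def pairRhs (c₅ c₇ : ℂ) (B : ℂ → ℂ) (a b : Comp) (ε m : ℕ) : phaseSpace 1 0 T → ℂ := fun u =>
  c₅ / 2 * (cv T b m u ^ 2 - cv T b (m + 1) u ^ 2) + c₇ * dv T b m u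
    + B (dv T b m u) * cv T a (m + ε) u

/-- The two components `a` and `b` of a reduced system with the coefficients `Ba` and `Bb` of the
coupling terms. -/
structure IsPair (Y : VField (phaseSpace 1 0 T)) (c₅ c₇ : ℂ) (a b : Comp) (Ba Bb : ℂ → ℂ)
    (ε δ : ℕ) : Prop where
  isOpen : IsOpen T
  ne : a ≠ b
  add_eq_one : ε + δ = 1
  analytic_a : AnalyticOnNhd ℂ Ba T
  analytic_b : AnalyticOnNhd ℂ Bb T
  apply_a : ∀ k : ℕ, Y (a, (k : ℤ)) =
    fun u => ∑ m ∈ Finset.range k, pairRhs T c₅ c₇ Ba b a δ m u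
  apply_b : ∀ k : ℕ, Y (b, (k : ℤ)) =
    fun u => ∑ m ∈ Finset.range k, pairRhs T c₅ c₇ Bb a b ε m u

variable {T}

section Act

variable (hT : IsOpen T) {Z : VField (phaseSpace 1 0 T)}

include hT

lemma hasAct_cv (j : Comp) (k : ℕ) : HasAct Z (cv T j k) (Z (j, (k : ℤ))) :=
  HasAct.coord (coordOpen_phaseSpace hT) _

lemma hasAct_dv (j : Comp) (k : ℕ) :
    HasAct Z (dv T j k) (fun u => Z (j, (k : ℤ)) u - Z (j, ((k + 1 : ℕ) : ℤ)) u) :=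
  (hasAct_cv hT j k).sub (coordOpen_phaseSpace hT) (hasAct_cv hT j (k + 1))

lemma hasAct_pairRhs {B : ℂ → ℂ} (hB : AnalyticOnNhd ℂ B T) (c₅ c₇ : ℂ) (a b : Comp) (ε m : ℕ) :
    HasAct Z (pairRhs T c₅ c₇ B a b ε m) (fun u =>
      c₅ * (cv T b m u * Z (b, (m : ℤ)) u - cv T b (m + 1) u * Z (b, ((m + 1 : ℕ) : ℤ)) u)
      + c₇ * (Z (b, (m : ℤ)) u - Z (b, ((m + 1 : ℕ) : ℤ)) u)
      + (deriv B (dv T b m u) * (Z (b, (m : ℤ)) u - Z (b, ((m + 1 : ℕ) : ℤ)) u) *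
          cv T a (m + ε) u + B (dv T b m u) * Z (a, ((m + ε : ℕ) : ℤ)) u)) := by
  have hΩ := coordOpen_phaseSpace (N₁ := 1) (N₂ := 0) hT
  have h1 := (((((hasAct_cv (Z := Z) hT b m).pow hΩ 2).sub hΩ
    ((hasAct_cv hT b (m + 1)).pow hΩ 2)).const_mul hΩ (c₅ / 2)).add hΩ
    ((hasAct_dv hT b m).const_mul hΩ c₇)).add hΩ
    (((hasAct_dv hT b m).comp hΩ hB (dv_mem T b m)).mul hΩ (hasAct_cv hT a (m + ε)))
  refine h1.congr rfl ?_
  ext u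
  push_cast
  ring

end Act

/-- A single variable can be moved freely near each point of `Ω`. -/
lemma CoordOpen.eventually_exists {ι : Type} {Ω : Set (ι → ℂ)} (hΩ : CoordOpen Ω) (u : Ω) (i : ι) :
    ∀ᶠ t in 𝓝 (u.1 i), ∃ w : Ω, w.1 i = t ∧ ∀ k ≠ i, w.1 k = u.1 k := by
  filter_upwards [hΩ u.1 u.2 i] with t ht
  exact ⟨⟨_, ht⟩, by simp, fun k hk => by simp [hk]⟩

namespace IsPair

variable {Y : VField (phaseSpace 1 0 T)} {c₅ c₇ : ℂ} {a b : Comp} {Ba Bb : ℂ → ℂ} {ε δ : ℕ}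

lemma symm (h : IsPair T Y c₅ c₇ a b Ba Bb ε δ) : IsPair T Y c₅ c₇ b a Bb Ba δ ε :=
  ⟨h.isOpen, h.ne.symm, by rw [add_comm, h.add_eq_one], h.analytic_b, h.analytic_a,
    h.apply_b, h.apply_a⟩

variable (h : IsPair T Y c₅ c₇ a b Ba Bb ε δ)

include h

lemma coordOpen : CoordOpen (phaseSpace 1 0 T) := coordOpen_phaseSpace h.isOpen

/-- X_b translates all u^b simultaneously. The coupling term of the b-equation sees u^b only through
differences, so it drops out, and the quadratic part becomes a telescoping sum. -/
lemma bracket_fieldX_apply_b (k : ℕ) :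
    VField.bracket (fieldX 1 0 T b) Y (b, (k : ℤ)) =
      fun u => c₅ * (cv T b 0 u - cv T b k u) := by
  ext u
  have h1 := (HasAct.sum (Z := fieldX 1 0 T b) h.coordOpen (Finset.range k) fun m _ =>
    hasAct_pairRhs h.isOpen h.analytic_b c₅ c₇ a b ε m).congr (h.apply_b k).symm rfl
  have h2 : HasAct Y (fieldX 1 0 T b (b, (k : ℤ))) (fun _ => 0) := HasAct.const _
  rw [bracket_apply h1 h2, ← sum_dv, Finset.mul_sum, sub_zero]
  refine Finset.sum_congr rfl fun m _ => ?_
  simp [fieldX, h.ne, dv]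

lemma bracket_fieldX_apply_a (k : ℕ) :
    VField.bracket (fieldX 1 0 T b) Y (a, (k : ℤ)) =
      fun u => ∑ m ∈ Finset.range k, Ba (dv T a m u) := by
  ext u
  have h1 := (HasAct.sum (Z := fieldX 1 0 T b) h.coordOpen (Finset.range k) fun m _ =>
    hasAct_pairRhs h.isOpen h.analytic_a c₅ c₇ b a δ m).congr (h.apply_a k).symm rfl
  have h2 : HasAct Y (fieldX 1 0 T b (a, (k : ℤ))) (fun _ => 0) := HasAct.const _
  rw [bracket_apply h1 h2, sub_zero]
  refine Finset.sum_congr rfl fun m _ => ?_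
  simp [fieldX, h.ne]

end IsPair

end TwoComponents

/-! ### Elimination of the logarithms -/

section Logarithms

/-- `κ₀ = τ`, `κ_{i+1} = -B κ_i'`. -/
def iterKappa (B : ℂ → ℂ) : ℕ → ℂ → ℂ
  | 0 => fun z => z
  | i + 1 => fun z => -B z * deriv (iterKappa B i) z

/-- The coefficients of the expansion of the iterated commutators. -/
def iterMu (c : ℂ) (B : ℂ → ℂ) : ℕ → ℕ → ℂ → ℂ
  | 0, 0 => B
  | 0, _ + 1 => fun _ => 0
  | s + 1, 0 => fun z => c * iterMu c B s 0 z - c * z * deriv (iterMu c B s 0) z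
  | s + 1, i + 1 => fun z => c * iterMu c B s (i + 1) z - c * z * deriv (iterMu c B s (i + 1)) z
      + iterMu c B s i z

lemma analyticOnNhd_iterKappa {B : ℂ → ℂ} {T : Set ℂ} (hB : AnalyticOnNhd ℂ B T) (i : ℕ) :
    AnalyticOnNhd ℂ (iterKappa B i) T := by
  induction i with
  | zero => exact analyticOnNhd_id
  | succ i ih => exact hB.neg.mul ih.deriv

lemma analyticOnNhd_iterMu (c : ℂ) {B : ℂ → ℂ} {T : Set ℂ} (hB : AnalyticOnNhd ℂ B T) (s i : ℕ) :
    AnalyticOnNhd ℂ (iterMu c B s i) T := by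
  induction s generalizing i with
  | zero =>
    cases i with
    | zero => exact hB
    | succ i => exact analyticOnNhd_const
  | succ s ih =>
    cases i with
    | zero =>
      exact (analyticOnNhd_const.mul (ih 0)).sub
        ((analyticOnNhd_const.mul analyticOnNhd_id).mul (ih 0).deriv)
    | succ i =>
      exact ((analyticOnNhd_const.mul (ih (i + 1))).sub
        ((analyticOnNhd_const.mul analyticOnNhd_id).mul (ih (i + 1)).deriv)).add (ih i)

lemma iterMu_eq_zero (c : ℂ) (B : ℂ → ℂ) {s i : ℕ} (h : s < i) : iterMu c B s i = fun _ => 0 := by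
  induction s generalizing i with
  | zero =>
    cases i with
    | zero => omega
    | succ i => rfl
  | succ s ih =>
    cases i with
    | zero => omega
    | succ i =>
      ext z
      simp [iterMu, ih (show s < i + 1 by omega), ih (show s < i by omega)]

lemma iterMu_self (c : ℂ) (B : ℂ → ℂ) (s : ℕ) : iterMu c B s s = B := by
  induction s with
  | zero => rfl
  | succ s ih =>
    ext z
    simp [iterMu, ih, iterMu_eq_zero c B (Nat.lt_succ_self s)]

variable {T : Set ℂ} {Y : VField (phaseSpace 1 0 T)} {c₅ c₇ : ℂ} {a b : Comp} {Ba Bb : ℂ → ℂ}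
  {ε δ : ℕ}

/-- The iterated derivatives of `u^a_n` along the commutator of `X_b` and `Y`. -/
def iterU (T : Set ℂ) (Ba : ℂ → ℂ) (a : Comp) (n i : ℕ) : phaseSpace 1 0 T → ℂ := fun u =>
  (if i = 0 then cv T a 0 u else 0) - ∑ l ∈ Finset.range n, iterKappa Ba i (dv T a l u)

/-- The summands of the coefficients of the iterated commutators. -/
def iterH (T : Set ℂ) (c₅ c₇ : ℂ) (Ba Bb : ℂ → ℂ) (a b : Comp) (ε s m : ℕ) :
    phaseSpace 1 0 T → ℂ := fun u =>
  (c₅ / 2 * (-c₅) ^ s) *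
      (dv T b m u * ((cv T b m u - cv T b 0 u) + (cv T b (m + 1) u - cv T b 0 u)))
    + 0 ^ s * ((c₅ * cv T b 0 u + c₇) * dv T b m u)
    + ∑ i ∈ Finset.range (s + 1), iterMu c₅ Bb s i (dv T b m u) * iterU T Ba a (m + ε) i u

namespace IsPair

variable (h : IsPair T Y c₅ c₇ a b Ba Bb ε δ)

include h

/-- Z annihilates u^a_0 and sends each difference τ of neighbouring u^a to -Ba(τ), which is the
recursion of `iterKappa`; the case i = 0 is u^a_n itself, by telescoping. -/
lemma hasAct_iterU (n i : ℕ) :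
    HasAct (VField.bracket (fieldX 1 0 T b) Y) (iterU T Ba a n i) (iterU T Ba a n (i + 1)) := by
  have hΩ := h.coordOpen
  have h0 : HasAct (VField.bracket (fieldX 1 0 T b) Y)
      (fun u => if i = 0 then cv T a 0 u else 0) (fun _ => 0) := by
    by_cases hi : i = 0
    · simp only [hi, if_true]
      refine (hasAct_cv h.isOpen a 0).congr rfl ?_
      rw [h.bracket_fieldX_apply_a]
      simp
    · simp only [hi, if_false]
      exact HasAct.const 0
  refine (h0.sub hΩ (HasAct.sum hΩ (Finset.range n) fun l _ =>
    (hasAct_dv h.isOpen a l).comp hΩ (analyticOnNhd_iterKappa h.analytic_a i)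
      (dv_mem T a l))).congr rfl ?_
  ext u
  simp only [iterU, h.bracket_fieldX_apply_a, Finset.sum_range_succ, iterKappa]
  simp [mul_comm]

/-- In the direction b the components of Z are c₅(u^b_0 - u^b_k), so a bracket with a field W
without u^b_0-component is Z(W_b) + c₅ W_b. The summands are therefore iterated by Z + c₅, which
multiplies the quadratic part by -c₅ and kills the linear part; this explains the factors (-c₅)^s
and 0^s. -/
lemma hasAct_iterH (s m : ℕ) :
    HasAct (VField.bracket (fieldX 1 0 T b) Y) (iterH T c₅ c₇ Ba Bb a b ε s m)
      (fun u => iterH T c₅ c₇ Ba Bb a b ε (s + 1) m u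
        - c₅ * iterH T c₅ c₇ Ba Bb a b ε s m u) := by
  have hΩ := h.coordOpen
  have hb := fun k => hasAct_cv (Z := VField.bracket (fieldX 1 0 T b) Y) h.isOpen b k
  have hd := hasAct_dv (Z := VField.bracket (fieldX 1 0 T b) Y) h.isOpen b m
  simp only [h.bracket_fieldX_apply_b] at hb hd
  have h1 := ((hd.mul hΩ (((hb m).sub hΩ (hb 0)).add hΩ
    ((hb (m + 1)).sub hΩ (hb 0)))).const_mul hΩ (c₅ / 2 * (-c₅) ^ s))
  have h2 := ((((hb 0).const_mul hΩ c₅).add hΩ (HasAct.const c₇)).mul hΩ hd).const_mul hΩ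
    ((0 : ℂ) ^ s)
  have h3 := HasAct.sum hΩ (Finset.range (s + 1)) fun i _ =>
    (hd.comp hΩ (analyticOnNhd_iterMu c₅ h.analytic_b s i) (dv_mem T b m)).mul hΩ
      (h.hasAct_iterU (m + ε) i)
  refine ((h1.add hΩ h2).add hΩ h3).congr rfl ?_
  ext u
  have e3 : ∑ i ∈ Finset.range (s + 1 + 1),
      iterMu c₅ Bb (s + 1) i (dv T b m u) * iterU T Ba a (m + ε) i u =
      ∑ i ∈ Finset.range (s + 1), ((c₅ * iterMu c₅ Bb s i (dv T b m u) -
        c₅ * dv T b m u * deriv (iterMu c₅ Bb s i) (dv T b m u)) * iterU T Ba a (m + ε) i u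
        + iterMu c₅ Bb s i (dv T b m u) * iterU T Ba a (m + ε) (i + 1) u) := by
    rw [Finset.sum_add_distrib, Finset.sum_range_succ', Finset.sum_range_succ' (n := s)
      (f := fun i => (c₅ * iterMu c₅ Bb s i (dv T b m u) -
        c₅ * dv T b m u * deriv (iterMu c₅ Bb s i) (dv T b m u)) * iterU T Ba a (m + ε) i u)]
    -- The extra top term may be included because the coefficient with i = s + 1 vanishes at level
    -- s.
    have e4 : ∑ i ∈ Finset.range s, (c₅ * iterMu c₅ Bb s (i + 1) (dv T b m u) -
        c₅ * dv T b m u * deriv (iterMu c₅ Bb s (i + 1)) (dv T b m u)) *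
          iterU T Ba a (m + ε) (i + 1) u =
        ∑ i ∈ Finset.range (s + 1), (c₅ * iterMu c₅ Bb s (i + 1) (dv T b m u) -
        c₅ * dv T b m u * deriv (iterMu c₅ Bb s (i + 1)) (dv T b m u)) *
          iterU T Ba a (m + ε) (i + 1) u := by
      rw [Finset.sum_range_succ, iterMu_eq_zero c₅ Bb (Nat.lt_succ_self s)]
      simp
    rw [e4]
    simp only [iterMu, add_mul, Finset.sum_add_distrib]
    ring
  simp only [iterH]
  rw [e3, Finset.sum_add_distrib]
  have e5 : ∀ f g k : ℕ → ℂ, (∀ i, f i = g i - c₅ * k i) →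
    ∑ i ∈ Finset.range (s + 1), f i = ∑ i ∈ Finset.range (s + 1), g i
      - c₅ * ∑ i ∈ Finset.range (s + 1), k i := by
    intro f g k hf
    rw [Finset.mul_sum, ← Finset.sum_sub_distrib]
    exact Finset.sum_congr rfl fun i _ => hf i
  rw [Finset.sum_add_distrib, e5 (fun i => deriv (iterMu c₅ Bb s i) (dv T b m u) *
      (c₅ * (cv T b 0 u - cv T b m u) - c₅ * (cv T b 0 u - cv T b (m + 1) u)) *
        iterU T Ba a (m + ε) i u) (fun i => (c₅ * iterMu c₅ Bb s i (dv T b m u) -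
        c₅ * dv T b m u * deriv (iterMu c₅ Bb s i) (dv T b m u)) * iterU T Ba a (m + ε) i u)
      (fun i => iterMu c₅ Bb s i (dv T b m u) * iterU T Ba a (m + ε) i u)
      (fun i => by simp only [dv]; ring)]
  simp only [dv, pow_succ]
  ring

lemma adIter_apply_b (s k : ℕ) :
    adIter (VField.bracket (fieldX 1 0 T b) Y) Y s (b, (k : ℤ)) =
      fun u => ∑ m ∈ Finset.range k, iterH T c₅ c₇ Ba Bb a b ε s m u := by
  induction s generalizing k with
  | zero =>
    rw [adIter, h.apply_b]
    ext u
    refine Finset.sum_congr rfl fun m _ => ?_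
    have e := sum_dv T a (m + ε) u
    simp only [iterH, pairRhs, iterU, zero_add, Finset.sum_range_one, iterMu, iterKappa, e,
      pow_zero, if_true, sub_sub_cancel]
    simp only [dv]
    ring
  | succ s ih =>
    ext u
    have h1 := (HasAct.sum h.coordOpen (Finset.range k) fun m _ =>
      h.hasAct_iterH s m).congr (ih k).symm rfl
    have h2 := (((hasAct_cv (Z := adIter (VField.bracket (fieldX 1 0 T b) Y) Y s)
      h.isOpen b 0).sub h.coordOpen (hasAct_cv h.isOpen b k)).const_mul
        h.coordOpen c₅).congr (h.bracket_fieldX_apply_b k).symm rfl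
    rw [adIter, bracket_apply h1 h2, ih, ih]
    simp only [Finset.sum_sub_distrib, Finset.mul_sum, Finset.range_zero, Finset.sum_empty,
      zero_sub, mul_neg, sub_neg_eq_add, sub_add_cancel]

end IsPair

end Logarithms

/-! ### Independence of the iterates τ P_i(log τ) -/

section LogPolynomials

open Polynomial

/-- `P₀ = 1`, `P_{i+1} = -H (P_i + P_i')`. -/
def iterP (H : ℂ[X]) : ℕ → ℂ[X]
  | 0 => 1
  | i + 1 => -(H * (iterP H i + derivative (iterP H i)))

lemma degree_add_derivative {P : ℂ[X]} (hP : P ≠ 0) : (P + derivative P).degree = P.degree :=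
  degree_add_eq_left_of_degree_lt (degree_derivative_lt hP)

lemma iterP_ne_zero {H : ℂ[X]} (hH : H ≠ 0) (i : ℕ) : iterP H i ≠ 0 := by
  induction i with
  | zero => exact one_ne_zero
  | succ i ih =>
    refine neg_ne_zero.2 (mul_ne_zero hH fun h0 => ih ?_)
    rw [← degree_eq_bot, ← degree_add_derivative ih, h0, degree_zero]

/-- Adding the derivative leaves the degree unchanged, so each step contributes exactly the degree
of H. -/
lemma natDegree_iterP {H : ℂ[X]} (hH : H ≠ 0) (i : ℕ) :
    (iterP H i).natDegree = i * H.natDegree := by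
  induction i with
  | zero => simp [iterP]
  | succ i ih =>
    have h1 := degree_add_derivative (iterP_ne_zero hH i)
    have h2 : iterP H i + derivative (iterP H i) ≠ 0 := fun h0 => by
      rw [h0, degree_zero, eq_comm, degree_eq_bot] at h1
      exact iterP_ne_zero hH i h1
    rw [iterP, natDegree_neg, natDegree_mul hH h2, natDegree_eq_of_degree_eq h1, ih]
    ring

/-- The lower triangular combinations of the polynomials `P_i` with constant nonzero diagonal
coefficients are linearly independent. -/
lemma eq_zero_of_sum_iterP_eq_zero {H : ℂ[X]} (hH : 1 ≤ H.natDegree) {M : ℕ → ℕ → ℂ}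
    (hM : ∀ s, M s s ≠ 0) {γ : ℕ → ℂ} {t : Finset ℕ}
    (h : ∑ s ∈ t, C (γ s) * ∑ i ∈ Finset.range (s + 1), C (M s i) * iterP H i = 0) :
    ∀ s ∈ t, γ s = 0 := by
  have hH0 : H ≠ 0 := by rintro rfl; simp at hH
  by_contra! hne
  obtain ⟨s₀, hs₀, hmax⟩ := (t.filter fun s => γ s ≠ 0).exists_max_image id
    (by obtain ⟨s, hs, h0⟩ := hne; exact ⟨s, by simp [hs, h0]⟩)
  simp only [Finset.mem_filter, id] at hs₀ hmax
  have hc := congrArg (fun P => coeff P (s₀ * H.natDegree)) h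
  have hlow : ∀ i < s₀, (iterP H i).coeff (s₀ * H.natDegree) = 0 := by
    intro i hi
    refine coeff_eq_zero_of_natDegree_lt ?_
    rw [natDegree_iterP hH0]
    exact Nat.mul_lt_mul_of_pos_right hi hH
  simp only [finsetSum_coeff, coeff_C_mul, coeff_zero] at hc
  rw [Finset.sum_eq_single_of_mem s₀ hs₀.1, Finset.sum_range_succ,
    Finset.sum_eq_zero (fun i hi => by rw [hlow i (Finset.mem_range.1 hi), mul_zero]), zero_add]
    at hc
  · have hl : (iterP H s₀).coeff (s₀ * H.natDegree) ≠ 0 := by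
      rw [← natDegree_iterP hH0, coeff_natDegree, Ne, leadingCoeff_eq_zero]
      exact iterP_ne_zero hH0 s₀
    exact mul_ne_zero hs₀.2 (mul_ne_zero (hM s₀) hl) hc
  · intro s hs hne
    by_cases hγ : γ s = 0
    · rw [hγ, zero_mul]
    · have := hmax s ⟨hs, hγ⟩
      rw [Finset.sum_eq_zero, mul_zero]
      intro i hi
      rw [hlow i (by have := Finset.mem_range.1 hi; omega), mul_zero]

variable {V : Set ℂ} {ℓ : ℂ → ℂ}

lemma hasDerivAt_logBranch (hV : IsOpen V) (hc : ContinuousOn ℓ V)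
    (hℓ : ∀ τ ∈ V, Complex.exp (ℓ τ) = τ) {τ : ℂ} (hτ : τ ∈ V) : HasDerivAt ℓ τ⁻¹ τ := by
  have h1 := Complex.hasDerivAt_exp (ℓ τ)
  rw [hℓ τ hτ] at h1
  refine HasDerivAt.of_local_left_inverse (hc.continuousAt (hV.mem_nhds hτ)) h1 ?_ ?_
  · rw [← hℓ τ hτ]; exact Complex.exp_ne_zero _
  · filter_upwards [hV.mem_nhds hτ] with y hy using hℓ y hy

/-- Differentiation of τ P(log τ) becomes P ↦ P + P', which is the operation in `iterP`. -/
lemma hasDerivAt_mul_eval_logBranch (hV : IsOpen V) (hc : ContinuousOn ℓ V)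
    (hℓ : ∀ τ ∈ V, Complex.exp (ℓ τ) = τ) (P : ℂ[X]) {τ : ℂ} (hτ : τ ∈ V) :
    HasDerivAt (fun z => z * P.eval (ℓ z)) ((P + derivative P).eval (ℓ τ)) τ := by
  have h0 : τ ≠ 0 := by rw [← hℓ τ hτ]; exact Complex.exp_ne_zero _
  have h1 := (hasDerivAt_id τ).mul ((P.hasDerivAt (ℓ τ)).comp τ (hasDerivAt_logBranch hV hc hℓ hτ))
  refine h1.congr_deriv ?_
  simp
  field_simp

lemma iterKappa_eq (hV : IsOpen V) (hc : ContinuousOn ℓ V)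
    (hℓ : ∀ τ ∈ V, Complex.exp (ℓ τ) = τ) {B : ℂ → ℂ} {H : ℂ[X]}
    (hB : ∀ τ ∈ V, B τ = τ * H.eval (ℓ τ)) (i : ℕ) :
    ∀ τ ∈ V, iterKappa B i τ = τ * (iterP H i).eval (ℓ τ) := by
  induction i with
  | zero => intro τ _; simp [iterKappa, iterP]
  | succ i ih =>
    intro τ hτ
    have he : iterKappa B i =ᶠ[𝓝 τ] fun z => z * (iterP H i).eval (ℓ z) := by
      filter_upwards [hV.mem_nhds hτ] with z hz using ih z hz
    simp only [iterKappa]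
    rw [he.deriv_eq, (hasDerivAt_mul_eval_logBranch hV hc hℓ _ hτ).deriv, hB τ hτ]
    simp [iterP]
    ring

/-- Differentiating removes the constant and leaves Q + Q' vanishing at log τ. Since the branch is
injective, these are infinitely many roots, and Q + Q' has the degree of Q. -/
lemma eq_zero_of_mul_eval_logBranch_eq_const (hV : IsOpen V) (hc : ContinuousOn ℓ V)
    (hℓ : ∀ τ ∈ V, Complex.exp (ℓ τ) = τ) {Q : ℂ[X]} {v c : ℂ} (hv : v ∈ V)
    (hQ : ∀ᶠ τ in 𝓝 v, τ * Q.eval (ℓ τ) = c) : Q = 0 := by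
  have h1 : ∀ᶠ τ in 𝓝 v, τ ∈ V ∧ (Q + derivative Q).eval (ℓ τ) = 0 := by
    filter_upwards [hQ.eventually_nhds, hV.mem_nhds hv] with τ hτ hτV
    refine ⟨hτV, ?_⟩
    rw [← (hasDerivAt_mul_eval_logBranch hV hc hℓ Q hτV).deriv,
      EventuallyEq.deriv_eq (f := fun _ => c) hτ, deriv_const]
  have h2 : Q + derivative Q = 0 := by
    refine eq_zero_of_infinite_isRoot _ ?_
    have hinf : {τ | τ ∈ V ∧ (Q + derivative Q).eval (ℓ τ) = 0}.Infinite :=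
      infinite_of_mem_nhds v h1
    refine (hinf.image (f := ℓ) fun x hx y hy hxy => ?_).mono ?_
    · rw [← hℓ x hx.1, ← hℓ y hy.1, hxy]
    · rintro _ ⟨τ, hτ, rfl⟩
      exact hτ.2
  by_contra hne
  have := degree_add_derivative hne
  rw [h2, degree_zero, eq_comm, degree_eq_bot] at this
  exact hne this

lemma eq_zero_of_sum_iterKappa_eq_const (hV : IsOpen V) (hc : ContinuousOn ℓ V)
    (hℓ : ∀ τ ∈ V, Complex.exp (ℓ τ) = τ) {B : ℂ → ℂ} {H : ℂ[X]}
    (hB : ∀ τ ∈ V, B τ = τ * H.eval (ℓ τ)) (hH : 1 ≤ H.natDegree) {M : ℕ → ℕ → ℂ}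
    (hM : ∀ s, M s s ≠ 0) {γ : ℕ → ℂ} {t : Finset ℕ} {v c : ℂ} (hv : v ∈ V)
    (h : ∀ᶠ τ in 𝓝 v,
      ∑ s ∈ t, γ s * ∑ i ∈ Finset.range (s + 1), M s i * iterKappa B i τ = c) :
    ∀ s ∈ t, γ s = 0 := by
  refine eq_zero_of_sum_iterP_eq_zero hH hM
    (eq_zero_of_mul_eval_logBranch_eq_const (c := c) hV hc hℓ hv ?_)
  filter_upwards [h, hV.mem_nhds hv] with τ hτ hτV
  rw [← hτ]
  simp only [eval_finsetSum, eval_mul, eval_C, Finset.mul_sum]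
  refine Finset.sum_congr rfl fun s _ => Finset.sum_congr rfl fun i _ => ?_
  rw [iterKappa_eq hV hc hℓ hB i τ hτV]
  ring

end LogPolynomials

/-! ### Finite dimension excludes logarithms -/

section NoLogarithms

variable {T : Set ℂ} {Y : VField (phaseSpace 1 0 T)} {c₅ c₇ : ℂ} {a b : Comp} {Ba Bb : ℂ → ℂ}
  {ε δ : ℕ}

lemma exists_nat_forall_lt (F : Finset (Var 1 0)) : ∃ K : ℕ, ∀ i ∈ F, i.2 < (K : ℤ) := by
  refine ⟨F.sup fun i => (i.2 + 1).toNat, fun i hi => ?_⟩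
  have := Finset.le_sup (f := fun i : Var 1 0 => (i.2 + 1).toNat) hi
  have h2 : (i.2 + 1).toNat ≤ F.sup fun i => (i.2 + 1).toNat := this
  omega

/-- The differences of the variables may be prescribed to be constant from some place on. -/
lemma exists_tail (u : phaseSpace 1 0 T) (K : ℕ) {v : ℂ} (hv : v ∈ T) :
    ∃ w : phaseSpace 1 0 T, (∀ i, i.2 < (K : ℤ) → w.1 i = u.1 i) ∧
      ∀ j, ∀ k, K ≤ k → dv T j k w = v := by
  refine ⟨⟨fun i => if i.2 < (K : ℤ) then u.1 i else u.1 (i.1, (K : ℤ)) - (i.2 - K : ℤ) * v,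
    fun j k => ?_⟩, fun i hi => by simp [hi], fun j k hk => ?_⟩
  · dsimp only
    split_ifs with h1 h2 h2
    · exact u.2 j k
    · have e : k + 1 = K := by omega
      have := u.2 j k
      rw [e] at this ⊢
      simpa using this
    · omega
    · convert hv using 1
      push_cast
      ring
  · have h1 : ¬ ((k : ℤ) < K) := by omega
    have h2 : ¬ (((k + 1 : ℕ) : ℤ) < K) := by omega
    simp only [dv, cv, h1, h2, if_false]
    push_cast
    ring

/-- The coefficient of the coupling term contains no logarithms if the characteristic algebra is
finite-dimensional. -/
lemma IsPair.natDegree_eq_zero (h : IsPair T Y c₅ c₇ a b Ba Bb ε δ)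
    {S : Set (VField (phaseSpace 1 0 T))} (hY : Y ∈ S) (hX : fieldX 1 0 T b ∈ S)
    (hfin : Module.rank (analyticRing (phaseSpace 1 0 T))
      (lieRinehartSpan (phaseSpace 1 0 T) S) < Cardinal.aleph0)
    {V : Set ℂ} {ℓ : ℂ → ℂ} (hV : IsOpen V) (hVT : V ⊆ T) (hc : ContinuousOn ℓ V)
    (hℓ : ∀ τ ∈ V, Complex.exp (ℓ τ) = τ) {H : Polynomial ℂ}
    (hB : ∀ τ ∈ V, Ba τ = τ * H.eval (ℓ τ)) {v : ℂ} (hv : v ∈ V) (hBv : Bb v ≠ 0) :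
    H.natDegree = 0 := by
  by_contra hdeg
  have hY' := subset_lieRinehartSpan S hY
  have hX' := subset_lieRinehartSpan S hX
  have hne : Nonempty (phaseSpace 1 0 T) :=
    ⟨fun i => -(i.2 : ℂ) * v, fun j k => by
      convert hVT hv using 1
      push_cast
      ring⟩
  refine not_rank_lt_aleph0 _ _
    (adIter_mem_lieRinehartSpan (bracket_mem_lieRinehartSpan hX' hY') hY') ?_ hfin
  intro u F γ t hrel
  obtain ⟨K, hK⟩ := exists_nat_forall_lt F
  obtain ⟨w, hwu, hwv⟩ := exists_tail u K (hVT hv)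
  -- The summand m = K + 1 of the b-component contains u^a_{m+ε} = u^a_{n+1}. Moving this variable
  -- changes only the last difference, l = n, in `iterU`.
  obtain ⟨n, hn⟩ : ∃ n, n = K + ε := ⟨_, rfl⟩
  have hn' : K + 1 + ε = n + 1 := by omega
  have hrelH : ∀ w' : phaseSpace 1 0 T, (∀ i ∈ F, w'.1 i = u.1 i) →
      ∑ s ∈ t, γ s * iterH T c₅ c₇ Ba Bb a b ε s (K + 1) w' = 0 := by
    intro w' hw'
    -- Subtracting the relations for consecutive components isolates one summand.
    have h1 := hrel w' hw' (b, ((K + 1 : ℕ) : ℤ))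
    have h2 := hrel w' hw' (b, ((K + 1 + 1 : ℕ) : ℤ))
    simp only [h.adIter_apply_b] at h1 h2
    simp only [Finset.sum_range_succ _ (K + 1), mul_add, Finset.sum_add_distrib, h1,
      zero_add] at h2
    exact h2
  have hmove := h.coordOpen.eventually_exists w (a, ((n + 1 : ℕ) : ℤ))
  have hw0 := hrelH w fun i hi => hwu i (hK i hi)
  have hrange : ∀ w' : phaseSpace 1 0 T,
      (∀ k ≠ ((a, ((n + 1 : ℕ) : ℤ)) : Var 1 0), w'.1 k = w.1 k) →
      (∀ i ∈ F, w'.1 i = u.1 i) ∧ (∀ k, cv T b k w' = cv T b k w) ∧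
      (∀ k, k ≤ n → cv T a k w' = cv T a k w) := by
    intro w' hw'
    refine ⟨fun i hi => ?_, fun k => hw' _ ?_, fun k hk => hw' _ ?_⟩
    · rw [hw' i, hwu i (hK i hi)]
      rintro rfl
      have := hK _ hi
      push_cast at this
      omega
    · simp [h.ne.symm]
    · simp only [ne_eq, Prod.mk.injEq, true_and, Nat.cast_inj]
      omega
  -- The b-difference stays at v, so the coefficients μ_{s,i}(v) are constants with diagonal Bb(v) ≠
  -- 0; the a-difference τ varies near v, and c is the value of the sum at τ = v.
  refine eq_zero_of_sum_iterKappa_eq_const hV hc hℓ hB (Nat.one_le_iff_ne_zero.2 hdeg)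
    (M := fun s i => iterMu c₅ Bb s i v) (γ := γ) (t := t)
    (c := ∑ s ∈ t, γ s * ∑ i ∈ Finset.range (s + 1), iterMu c₅ Bb s i v * iterKappa Ba i v)
    (fun s => by rw [iterMu_self]; exact hBv) hv ?_
  have htend : Tendsto (fun τ => cv T a n w - τ) (𝓝 v) (𝓝 (w.1 (a, ((n + 1 : ℕ) : ℤ)))) := by
    have e : w.1 (a, ((n + 1 : ℕ) : ℤ)) = cv T a n w - v := by
      rw [← hwv a n (by omega), dv, sub_sub_cancel]; rfl
    rw [e]
    exact (continuous_const.sub continuous_id).continuousAt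
  filter_upwards [htend.eventually hmove] with τ ⟨w', hw't, hw'⟩
  obtain ⟨hF, hb, ha⟩ := hrange w' hw'
  have hτ := hrelH w' hF
  rw [← sub_eq_zero, ← Finset.sum_sub_distrib]
  rw [← sub_eq_zero.2 (hw0.trans hτ.symm), ← Finset.sum_sub_distrib]
  refine Finset.sum_congr rfl fun s _ => ?_
  rw [← mul_sub, ← mul_sub]
  congr 1
  have hdb : dv T b (K + 1) w' = v := by
    rw [← hwv b (K + 1) (by omega), dv, dv, hb, hb]
  have hU : ∀ i, iterU T Ba a (n + 1) i w - iterU T Ba a (n + 1) i w' =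
      iterKappa Ba i τ - iterKappa Ba i v := by
    intro i
    have hd : ∀ l ∈ Finset.range n, iterKappa Ba i (dv T a l w') = iterKappa Ba i (dv T a l w) := by
      intro l hl
      have := Finset.mem_range.1 hl
      rw [dv, dv, ha _ (by omega), ha _ (by omega)]
    have hdn : dv T a n w' = τ := by
      have e : cv T a (n + 1) w' = cv T a n w - τ := hw't
      rw [dv, ha n le_rfl, e, sub_sub_cancel]
    simp only [iterU, Finset.sum_range_succ _ n, Finset.sum_congr rfl hd, hdn,
      hwv a n (by omega), ha 0 (Nat.zero_le _)]
    ring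
  simp only [iterH, hb, hdb, hwv b (K + 1) (by omega), hn', add_sub_add_left_eq_sub]
  rw [← Finset.sum_sub_distrib, ← Finset.sum_sub_distrib]
  exact Finset.sum_congr rfl fun i _ => by rw [← mul_sub, ← mul_sub, hU]

end NoLogarithms

/-! ### The system without logarithms -/

section Quadratic

/-- `u^j_k - u^j_0` as a function on the phase space. -/
def xv (T : Set ℂ) (j : Comp) (k : ℕ) : phaseSpace 1 0 T → ℂ := fun u => cv T j k u - cv T j 0 u

/-- The coefficients of `p²`, `pq` and `q²` in the polynomials which describe the iterated
commutators. -/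
def quadCoeff (α β : ℂ) : ℕ → ℂ × ℂ × ℂ
  | 0 => (-(β + α / 2), β + α, -(α / 2))
  | n + 1 => (-(β + (n + 2) * (α / 2)) * (quadCoeff α β n).1,
      -(β + (n + 1) * (α / 2)) * (quadCoeff α β n).2.1 + α * (quadCoeff α β n).1,
      -(β + n * (α / 2)) * (quadCoeff α β n).2.2 + α / 2 * (quadCoeff α β n).2.1)

/-- The quadratic form in `p`, `q` with the coefficients `quadCoeff`, times a power of `p`. -/
def quadForm (α β : ℂ) (n : ℕ) (p q : ℂ) : ℂ :=
  ((quadCoeff α β n).1 * p ^ 2 + (quadCoeff α β n).2.1 * (p * q) + (quadCoeff α β n).2.2 * q ^ 2)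
    * p ^ n

/-- Up to sign, the leading coefficient is the product of β + iα/2 over 1 ≤ i ≤ n + 1. -/
lemma quadCoeff_fst_ne_zero {α β : ℂ} (h : ∀ i : ℕ, 1 ≤ i → β + i * (α / 2) ≠ 0) (n : ℕ) :
    (quadCoeff α β n).1 ≠ 0 := by
  induction n with
  | zero => simpa [quadCoeff] using neg_ne_zero.2 (h 1 le_rfl)
  | succ n ih =>
    refine mul_ne_zero (neg_ne_zero.2 ?_) ih
    have := h (n + 2) (by omega)
    push_cast at this
    exact this

variable {T : Set ℂ} {Y : VField (phaseSpace 1 0 T)} {c₅ c₇ : ℂ} {a b : Comp} {Ba Bb : ℂ → ℂ}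
  {ε δ : ℕ} {κa κb : ℂ}

/-- The part of `Y` which is quadratic in the variables `u^a` and linear in the variables `u^b`,
up to a constant factor. -/
def pairD (Y : VField (phaseSpace 1 0 T)) (c₅ : ℂ) (b : Comp) :
    VField (phaseSpace 1 0 T) :=
  (fun i u => VField.bracket (VField.bracket (fieldX 1 0 T b) Y)
      (VField.bracket (VField.bracket (fieldX 1 0 T b) Y) Y) i u) +
    (fun i u => c₅ * VField.bracket (VField.bracket (fieldX 1 0 T b) Y) Y i u)

namespace IsPair

section Fields

variable (h : IsPair T Y c₅ c₇ a b Ba Bb ε δ)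

include h

lemma apply_b_eq_sum (hBb : ∀ τ ∈ T, Bb τ = κb * τ) (k : ℕ) :
    Y (b, (k : ℤ)) = fun u => ∑ m ∈ Finset.range k,
      (c₅ / 2 * (dv T b m u * (xv T b m u + xv T b (m + 1) u))
        + (c₅ * cv T b 0 u + c₇ + κb * cv T a 0 u) * dv T b m u
        + κb * (dv T b m u * xv T a (m + ε) u)) := by
  rw [h.apply_b]
  ext u
  refine Finset.sum_congr rfl fun m _ => ?_
  simp only [pairRhs]
  rw [hBb _ (dv_mem T b m u)]
  simp only [dv, xv]
  ring

/-- Summation by parts moves the differences from u^a to u^b; the relation ε + δ = 1 turns the shift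
δ into ε, so both components of Y involve the same products. -/
lemma apply_a_eq (hBa : ∀ τ ∈ T, Ba τ = κa * τ) (k : ℕ) :
    Y (a, (k : ℤ)) = fun u => -(c₅ / 2) * xv T a k u ^ 2
      - (c₅ * cv T a 0 u + c₇ + κa * cv T b 0 u) * xv T a k u
      - κa * ∑ l ∈ Finset.range k, dv T b l u * (xv T a (l + ε) u - xv T a k u) := by
  rw [h.apply_a]
  ext u
  induction k with
  | zero => simp [xv]
  | succ k ih =>
    rw [Finset.sum_range_succ, ih, Finset.sum_range_succ]
    have e1 := sum_dv T b k u
    simp only [mul_sub, Finset.sum_sub_distrib, ← Finset.sum_mul, e1]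
    simp only [pairRhs]
    rw [hBa _ (dv_mem T a k u)]
    have hε : ε = 0 ∧ δ = 1 ∨ ε = 1 ∧ δ = 0 := by have := h.add_eq_one; omega
    rcases hε with ⟨rfl, rfl⟩ | ⟨rfl, rfl⟩ <;> simp only [xv, dv, add_zero] <;> ring

lemma bracket_fieldX_apply_a_eq (hBa : ∀ τ ∈ T, Ba τ = κa * τ) (k : ℕ) :
    VField.bracket (fieldX 1 0 T b) Y (a, (k : ℤ)) = fun u => -κa * xv T a k u := by
  rw [h.bracket_fieldX_apply_a]
  ext u
  rw [Finset.sum_congr rfl fun m _ => hBa _ (dv_mem T a m u), ← Finset.mul_sum, sum_dv]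
  simp only [xv]
  ring

lemma hasAct_xv (Z : VField (phaseSpace 1 0 T)) (j : Comp) (k : ℕ) :
    HasAct Z (xv T j k) (fun u => Z (j, (k : ℤ)) u - Z (j, ((0 : ℕ) : ℤ)) u) :=
  (hasAct_cv h.isOpen j k).sub h.coordOpen (hasAct_cv h.isOpen j 0)

lemma hasAct_bracket_xv_a (hBa : ∀ τ ∈ T, Ba τ = κa * τ) (k : ℕ) :
    HasAct (VField.bracket (fieldX 1 0 T b) Y) (xv T a k) (fun u => -κa * xv T a k u) := by
  refine (h.hasAct_xv _ a k).congr rfl ?_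
  simp only [h.bracket_fieldX_apply_a_eq hBa]
  ext u
  simp only [xv]
  ring

lemma hasAct_bracket_xv_b (k : ℕ) :
    HasAct (VField.bracket (fieldX 1 0 T b) Y) (xv T b k) (fun u => -c₅ * xv T b k u) := by
  refine (h.hasAct_xv _ b k).congr rfl ?_
  simp only [h.bracket_fieldX_apply_b]
  ext u
  simp only [xv]
  ring

lemma hasAct_bracket_dv_b (k : ℕ) :
    HasAct (VField.bracket (fieldX 1 0 T b) Y) (dv T b k) (fun u => -c₅ * dv T b k u) := by
  refine (hasAct_dv h.isOpen b k).congr rfl ?_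
  simp only [h.bracket_fieldX_apply_b]
  ext u
  simp only [dv]
  ring

lemma hasAct_bracket_cv_a_zero :
    HasAct (VField.bracket (fieldX 1 0 T b) Y) (cv T a 0) (fun _ => 0) := by
  refine (hasAct_cv h.isOpen a 0).congr rfl ?_
  rw [h.bracket_fieldX_apply_a]
  simp

lemma hasAct_bracket_cv_b_zero :
    HasAct (VField.bracket (fieldX 1 0 T b) Y) (cv T b 0) (fun _ => 0) := by
  refine (hasAct_cv h.isOpen b 0).congr rfl ?_
  rw [h.bracket_fieldX_apply_b]
  simp

/-- The commutator with `[X_b, Y]` in the direction of `b`. -/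
lemma bracket_bracket_apply_b (W : VField (phaseSpace 1 0 T)) (r s t : ℂ)
    (hBa : ∀ τ ∈ T, Ba τ = κa * τ)
    (hW : ∀ k : ℕ, W (b, (k : ℤ)) = fun u => ∑ m ∈ Finset.range k,
      (r * (dv T b m u * (xv T b m u + xv T b (m + 1) u))
        + (s * (c₅ * cv T b 0 u + c₇ + κb * cv T a 0 u)) * dv T b m u
        + t * (dv T b m u * xv T a (m + ε) u))) (k : ℕ) :
    VField.bracket (VField.bracket (fieldX 1 0 T b) Y) W (b, (k : ℤ)) =
      fun u => ∑ m ∈ Finset.range k,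
        ((-c₅ * r) * (dv T b m u * (xv T b m u + xv T b (m + 1) u))
        + (0 * (c₅ * cv T b 0 u + c₇ + κb * cv T a 0 u)) * dv T b m u
        + (-κa * t) * (dv T b m u * xv T a (m + ε) u)) := by
  have hΩ := h.coordOpen
  have h1 := (HasAct.sum hΩ (Finset.range k) fun m _ =>
    ((((h.hasAct_bracket_dv_b m).mul hΩ ((h.hasAct_bracket_xv_b m).add hΩ
      (h.hasAct_bracket_xv_b (m + 1)))).const_mul hΩ r).add hΩ
    (((((h.hasAct_bracket_cv_b_zero.const_mul hΩ c₅).add hΩ (HasAct.const c₇)).add hΩ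
      (h.hasAct_bracket_cv_a_zero.const_mul hΩ κb)).const_mul hΩ s).mul hΩ
        (h.hasAct_bracket_dv_b m))).add hΩ
    (((h.hasAct_bracket_dv_b m).mul hΩ (h.hasAct_bracket_xv_a hBa (m + ε))).const_mul hΩ t)).congr
      (hW k).symm rfl
  have h2 := (((hasAct_cv (Z := W) h.isOpen b 0).sub hΩ (hasAct_cv h.isOpen b k)).const_mul
    hΩ c₅).congr (h.bracket_fieldX_apply_b k).symm rfl
  ext u
  rw [bracket_apply h1 h2, hW, hW]
  simp only [Finset.range_zero, Finset.sum_empty, zero_sub, mul_neg, sub_neg_eq_add,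
    Finset.mul_sum, ← Finset.sum_add_distrib]
  exact Finset.sum_congr rfl fun m _ => by ring

/-- The commutator with `[X_b, Y]` in the direction of `a`. -/
lemma bracket_bracket_apply_a (W : VField (phaseSpace 1 0 T)) (r s t : ℂ)
    (hBa : ∀ τ ∈ T, Ba τ = κa * τ)
    (hW : ∀ k : ℕ, W (a, (k : ℤ)) = fun u => r * xv T a k u ^ 2
      + (s * (c₅ * cv T a 0 u + c₇ + κa * cv T b 0 u)) * xv T a k u
      + t * ∑ l ∈ Finset.range k, dv T b l u * (xv T a (l + ε) u - xv T a k u)) (k : ℕ) :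
    VField.bracket (VField.bracket (fieldX 1 0 T b) Y) W (a, (k : ℤ)) =
      fun u => (-κa * r) * xv T a k u ^ 2
      + (0 * (c₅ * cv T a 0 u + c₇ + κa * cv T b 0 u)) * xv T a k u
      + (-c₅ * t) * ∑ l ∈ Finset.range k, dv T b l u * (xv T a (l + ε) u - xv T a k u) := by
  have hΩ := h.coordOpen
  have h1 := (((((h.hasAct_bracket_xv_a hBa k).pow hΩ 2).const_mul hΩ r).add hΩ
    (((((h.hasAct_bracket_cv_a_zero.const_mul hΩ c₅).add hΩ (HasAct.const c₇)).add hΩ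
      (h.hasAct_bracket_cv_b_zero.const_mul hΩ κa)).const_mul hΩ s).mul hΩ
        (h.hasAct_bracket_xv_a hBa k))).add hΩ
    ((HasAct.sum hΩ (Finset.range k) fun l _ => (h.hasAct_bracket_dv_b l).mul hΩ
      ((h.hasAct_bracket_xv_a hBa (l + ε)).sub hΩ (h.hasAct_bracket_xv_a hBa k))).const_mul
        hΩ t)).congr (hW k).symm rfl
  have h2 := ((h.hasAct_xv W a k).const_mul hΩ (-κa)).congr
    (h.bracket_fieldX_apply_a_eq hBa k).symm rfl
  ext u
  rw [bracket_apply h1 h2, hW, hW]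
  have e : ∑ l ∈ Finset.range k, (-c₅ * dv T b l u * (xv T a (l + ε) u - xv T a k u)
      + dv T b l u * (-κa * xv T a (l + ε) u - -κa * xv T a k u)) =
      (-c₅ - κa) * ∑ l ∈ Finset.range k, dv T b l u * (xv T a (l + ε) u - xv T a k u) := by
    rw [Finset.mul_sum]
    exact Finset.sum_congr rfl fun l _ => by ring
  have e0 : xv T a 0 u = 0 := sub_self _
  simp only [e, e0, Finset.range_zero, Finset.sum_empty]
  push_cast
  ring

end Fields

variable (h : IsPair T Y c₅ c₇ a b Ba Bb ε δ)

include h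

/-- Z is now linear and diagonal in the variables `xv` and `dv` of b and `xv` of a. The part of Y
linear in x^a has ad Z-eigenvalue 0 and the coupling part -c₅; ad Z (ad Z + c₅) kills both. The
square has eigenvalue -κa and survives with factor κa(κa - c₅). -/
lemma pairD_apply_a (hBa : ∀ τ ∈ T, Ba τ = κa * τ) (k : ℕ) :
    pairD Y c₅ b (a, (k : ℤ)) = fun u => -(κa * (κa - c₅) * c₅ / 2) * xv T a k u ^ 2 := by
  have h1 := h.bracket_bracket_apply_a Y (-(c₅ / 2)) (-1) (-κa) hBa
    (fun k => by rw [h.apply_a_eq hBa]; ext u; ring)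
  have h2 := h.bracket_bracket_apply_a _ _ _ _ hBa h1
  ext u
  simp only [pairD, Pi.add_apply, h1, h2]
  ring

lemma pairD_apply_b (hBa : ∀ τ ∈ T, Ba τ = κa * τ) (hBb : ∀ τ ∈ T, Bb τ = κb * τ) (k : ℕ) :
    pairD Y c₅ b (b, (k : ℤ)) = fun u => ∑ m ∈ Finset.range k,
      (κa * (κa - c₅) * κb) * (dv T b m u * xv T a (m + ε) u) := by
  have h1 := h.bracket_bracket_apply_b (κb := κb) Y (c₅ / 2) 1 κb hBa
    (fun k => by rw [h.apply_b_eq_sum hBb]; ext u; simp only [one_mul])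
  have h2 := h.bracket_bracket_apply_b _ _ _ _ hBa h1
  ext u
  simp only [pairD, Pi.add_apply, h1, h2, Finset.mul_sum, ← Finset.sum_add_distrib]
  exact Finset.sum_congr rfl fun m _ => by ring

/-- D sends x^a_k to -(α/2)(x^a_k)² and multiplies the l-th difference of u^b by -β x^a_{l+ε}, so
the l-th summand keeps its shape and its quadratic form follows the recursion of `quadCoeff`. The
remaining x² term commutes with the square in D and thus appears only for n = 0. -/
lemma adIter_pairD_apply (hBa : ∀ τ ∈ T, Ba τ = κa * τ) (hBb : ∀ τ ∈ T, Bb τ = κb * τ) {α β : ℂ}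
    (hα : α = κa * (κa - c₅) * c₅) (hβ : β = κa * (κa - c₅) * κb) (n k : ℕ) :
    adIter (pairD Y c₅ b) Y (n + 1) (a, (k : ℤ)) = fun u =>
      0 ^ n * (-(α / 2)) * ((c₅ * cv T a 0 u + c₇ + κa * cv T b 0 u) * xv T a k u ^ 2)
      - κa * ∑ l ∈ Finset.range k,
        dv T b l u * quadForm α β n (xv T a (l + ε) u) (xv T a k u) := by
  have hΩ := h.coordOpen
  have hx0 : ∀ j u, xv T j 0 u = 0 := fun j u => sub_self _
  have hDa : ∀ k : ℕ, pairD Y c₅ b (a, (k : ℤ)) = fun u => -(α / 2) * xv T a k u ^ 2 := by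
    intro k
    rw [h.pairD_apply_a hBa, hα]
  have hx : ∀ k, HasAct (pairD Y c₅ b) (xv T a k) (fun u => -(α / 2) * xv T a k u ^ 2) := by
    intro k
    refine (h.hasAct_xv _ a k).congr rfl ?_
    ext u
    simp only [hDa, hx0]
    ring
  have he : ∀ l, HasAct (pairD Y c₅ b) (dv T b l)
      (fun u => -β * (dv T b l u * xv T a (l + ε) u)) := by
    intro l
    refine (hasAct_dv h.isOpen b l).congr rfl ?_
    ext u
    simp only [h.pairD_apply_b hBa hBb, Finset.sum_range_succ, hβ]
    ring
  have ha0 : HasAct (pairD Y c₅ b) (cv T a 0) (fun _ => 0) := by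
    refine (hasAct_cv h.isOpen a 0).congr rfl ?_
    ext u
    simp only [hDa, hx0]
    ring
  have hb0 : HasAct (pairD Y c₅ b) (cv T b 0) (fun _ => 0) := by
    refine (hasAct_cv h.isOpen b 0).congr rfl ?_
    ext u
    simp only [h.pairD_apply_b hBa hBb, Finset.range_zero, Finset.sum_empty]
  have hlin := (((ha0.const_mul hΩ c₅).add hΩ (HasAct.const c₇)).add hΩ (hb0.const_mul hΩ κa))
  have hDk : ∀ (k : ℕ) (W : VField (phaseSpace 1 0 T)), HasAct W (pairD Y c₅ b (a, (k : ℤ)))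
      (fun u => -(α / 2) * (2 * xv T a k u *
        (W (a, (k : ℤ)) u - W (a, ((0 : ℕ) : ℤ)) u))) := by
    intro k W
    refine (((h.hasAct_xv W a k).pow hΩ 2).const_mul hΩ (-(α / 2))).congr (hDa k).symm ?_
    ext u
    simp
  induction n generalizing k with
  | zero =>
    have h1 := ((((hx k).pow hΩ 2).const_mul hΩ (-(c₅ / 2))).sub hΩ (hlin.mul hΩ (hx k))).sub hΩ
      ((HasAct.sum hΩ (Finset.range k) fun l _ => (he l).mul hΩ
        ((hx (l + ε)).sub hΩ (hx k))).const_mul hΩ κa)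
    have h2 := h1.congr (h.apply_a_eq hBa k).symm rfl
    ext u
    rw [adIter, adIter, bracket_apply h2 (hDk k Y), h.apply_a_eq hBa, h.apply_a_eq hBa]
    have e : ∑ l ∈ Finset.range k, dv T b l u * quadForm α β 0 (xv T a (l + ε) u) (xv T a k u)
        = ∑ l ∈ Finset.range k, (-β * (dv T b l u * xv T a (l + ε) u) *
            (xv T a (l + ε) u - xv T a k u) + dv T b l u *
            (-(α / 2) * xv T a (l + ε) u ^ 2 - -(α / 2) * xv T a k u ^ 2))
          + α * xv T a k u * ∑ l ∈ Finset.range k,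
            dv T b l u * (xv T a (l + ε) u - xv T a k u) := by
      rw [Finset.mul_sum, ← Finset.sum_add_distrib]
      refine Finset.sum_congr rfl fun l _ => ?_
      simp only [quadForm, quadCoeff]
      ring
    rw [e]
    simp only [hx0, Finset.range_zero, Finset.sum_empty]
    push_cast
    ring
  | succ n ih =>
    have hq : ∀ l, HasAct (pairD Y c₅ b)
        (fun u => quadForm α β n (xv T a (l + ε) u) (xv T a k u)) _ := fun l =>
      (((((hx (l + ε)).pow hΩ 2).const_mul hΩ (quadCoeff α β n).1).add hΩ
        (((hx (l + ε)).mul hΩ (hx k)).const_mul hΩ (quadCoeff α β n).2.1)).add hΩ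
        (((hx k).pow hΩ 2).const_mul hΩ (quadCoeff α β n).2.2)).mul hΩ ((hx (l + ε)).pow hΩ n)
    have h1 := ((hlin.mul hΩ ((hx k).pow hΩ 2)).const_mul hΩ (0 ^ n * (-(α / 2)))).sub hΩ
      ((HasAct.sum hΩ (Finset.range k) fun l _ => (he l).mul hΩ (hq l)).const_mul hΩ κa)
    have h2 := h1.congr (ih k).symm rfl
    ext u
    -- Truncated subtraction in the exponent is harmless at n = 0 because of the factor n.
    have hpow : ∀ p : ℂ, (n : ℂ) * p ^ (n - 1) * p ^ 2 = n * p ^ n * p := by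
      intro p
      rcases n with _ | n
      · simp
      · simp only [Nat.add_sub_cancel]; ring
    have e : ∑ l ∈ Finset.range k, dv T b l u *
          quadForm α β (n + 1) (xv T a (l + ε) u) (xv T a k u)
        = ∑ l ∈ Finset.range k, (-β * (dv T b l u * xv T a (l + ε) u) *
            quadForm α β n (xv T a (l + ε) u) (xv T a k u) + dv T b l u *
            (((quadCoeff α β n).1 * (((2 : ℕ) : ℂ) * xv T a (l + ε) u ^ (2 - 1) *
                (-(α / 2) * xv T a (l + ε) u ^ 2)) +
              (quadCoeff α β n).2.1 * (-(α / 2) * xv T a (l + ε) u ^ 2 * xv T a k u +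
                xv T a (l + ε) u * (-(α / 2) * xv T a k u ^ 2)) +
              (quadCoeff α β n).2.2 * (((2 : ℕ) : ℂ) * xv T a k u ^ (2 - 1) *
                (-(α / 2) * xv T a k u ^ 2))) * xv T a (l + ε) u ^ n +
              ((quadCoeff α β n).1 * xv T a (l + ε) u ^ 2 +
                (quadCoeff α β n).2.1 * (xv T a (l + ε) u * xv T a k u) +
                (quadCoeff α β n).2.2 * xv T a k u ^ 2) *
              (n * xv T a (l + ε) u ^ (n - 1) * (-(α / 2) * xv T a (l + ε) u ^ 2))))
          + α * xv T a k u * ∑ l ∈ Finset.range k,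
            dv T b l u * quadForm α β n (xv T a (l + ε) u) (xv T a k u) := by
      rw [Finset.mul_sum, ← Finset.sum_add_distrib]
      refine Finset.sum_congr rfl fun l _ => ?_
      simp only [quadForm, quadCoeff]
      push_cast
      linear_combination (α / 2) * dv T b l u * ((quadCoeff α β n).1 * xv T a (l + ε) u ^ 2 +
                (quadCoeff α β n).2.1 * (xv T a (l + ε) u * xv T a k u) +
                (quadCoeff α β n).2.2 * xv T a k u ^ 2) * hpow (xv T a (l + ε) u)
    rw [adIter, bracket_apply h2 (hDk k _), ih, ih, e]
    simp only [hx0, Finset.range_zero, Finset.sum_empty]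
    push_cast
    ring

end IsPair

end Quadratic

/-! ### Finite dimension forces integral coupling coefficients -/

section Integrality

lemma polynomial_eq_zero_of_eventually {P : Polynomial ℂ} {e q₀ : ℂ}
    (h : ∀ᶠ q in 𝓝 q₀, P.eval (q - e) = 0) : P = 0 := by
  refine Polynomial.eq_zero_of_infinite_isRoot _ ?_
  have hinf : {q | P.eval (q - e) = 0}.Infinite := infinite_of_mem_nhds q₀ h
  refine (hinf.image (f := fun q => q - e) fun x _ y _ hxy => sub_left_injective hxy).mono ?_
  rintro _ ⟨q, hq, rfl⟩
  exact hq

-- For fixed p the relation is polynomial in q, so it extends to q = e, where only the pure powers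
-- of p - e and r survive. Their degrees s + 2 are distinct and positive, so the constants r^{s+2}
-- do not interfere with the comparison of coefficients.
open Polynomial in
lemma eq_zero_of_sum_quadForm_eq_zero {α β : ℂ} (hα : ∀ n, (quadCoeff α β n).1 ≠ 0)
    {γ : ℕ → ℂ} {t : Finset ℕ} {e r p₀ q₀ : ℂ}
    (h : ∀ᶠ p in 𝓝 p₀, ∀ᶠ q in 𝓝 q₀,
      ∑ s ∈ t, γ s * (quadForm α β s (p - e) (q - e) - quadForm α β s r (q - e)) = 0) :
    ∀ s ∈ t, γ s = 0 := by
  have h1 : ∑ s ∈ t, C (γ s * (quadCoeff α β s).1) * (X ^ (s + 2) - C (r ^ (s + 2))) = 0 := by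
    refine polynomial_eq_zero_of_eventually (e := e) (q₀ := p₀) ?_
    filter_upwards [h] with p hp
    have h2 : ∑ s ∈ t, C (γ s) *
        ((C ((quadCoeff α β s).1 * (p - e) ^ 2) + C ((quadCoeff α β s).2.1 * (p - e)) * X
          + C (quadCoeff α β s).2.2 * X ^ 2) * C ((p - e) ^ s)
        - (C ((quadCoeff α β s).1 * r ^ 2) + C ((quadCoeff α β s).2.1 * r) * X
          + C (quadCoeff α β s).2.2 * X ^ 2) * C (r ^ s)) = 0 := by
      refine polynomial_eq_zero_of_eventually (e := e) (q₀ := q₀) ?_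
      filter_upwards [hp] with q hq
      rw [← hq, eval_finsetSum]
      refine Finset.sum_congr rfl fun s _ => ?_
      simp only [quadForm, eval_mul, eval_sub, eval_add, eval_C, eval_X, eval_pow]
      ring
    have h3 := congrArg (eval 0) h2
    rw [eval_zero] at h3
    rw [← h3, eval_finsetSum, eval_finsetSum]
    refine Finset.sum_congr rfl fun s _ => ?_
    simp only [eval_mul, eval_sub, eval_add, eval_C, eval_X, eval_pow]
    ring
  intro s hs
  have h2 := congrArg (fun P => coeff P (s + 2)) h1
  simp only [finsetSum_coeff, coeff_C_mul, coeff_sub, coeff_X_pow, coeff_C_succ, sub_zero,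
    coeff_zero, add_left_inj, mul_ite, mul_one, mul_zero, Finset.sum_ite_eq, hs, if_true] at h2
  exact (mul_eq_zero.1 h2).resolve_right (hα s)

variable {T : Set ℂ} {Y : VField (phaseSpace 1 0 T)} {c₅ c₇ : ℂ} {a b : Comp} {Ba Bb : ℂ → ℂ}
  {ε δ : ℕ} {κa κb : ℂ}

/-- The relation of the coupling coefficient to `c₅` if the characteristic algebra is
finite-dimensional. -/
lemma IsPair.exists_nat (h : IsPair T Y c₅ c₇ a b Ba Bb ε δ)
    (hBa : ∀ τ ∈ T, Ba τ = κa * τ) (hBb : ∀ τ ∈ T, Bb τ = κb * τ) (hTne : T.Nonempty)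
    {S : Set (VField (phaseSpace 1 0 T))} (hY : Y ∈ S) (hX : fieldX 1 0 T b ∈ S)
    (hfin : Module.rank (analyticRing (phaseSpace 1 0 T))
      (lieRinehartSpan (phaseSpace 1 0 T) S) < Cardinal.aleph0)
    (h0 : κa ≠ 0) (h5 : κa ≠ c₅) : ∃ i : ℕ, 1 ≤ i ∧ κb + i * (c₅ / 2) = 0 := by
  by_contra! hi
  have hY' := subset_lieRinehartSpan S hY
  have hX' := subset_lieRinehartSpan S hX
  have hZ := bracket_mem_lieRinehartSpan hX' hY'
  have hZY := bracket_mem_lieRinehartSpan hZ hY'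
  have hD : pairD Y c₅ b ∈ lieRinehartSpan (phaseSpace 1 0 T) S :=
    add_mem (bracket_mem_lieRinehartSpan hZ hZY) (const_smul_mem _ c₅ hZY)
  have hne : Nonempty (phaseSpace 1 0 T) := by
    obtain ⟨v, hv⟩ := hTne
    exact ⟨fun i => -(i.2 : ℂ) * v, fun j k => by
      convert hv using 1
      push_cast
      ring⟩
  refine not_rank_lt_aleph0 _ _ (fun s => adIter_mem_lieRinehartSpan hD hY' (s + 1)) ?_ hfin
  intro u F γ t hrel
  have hA := h.adIter_pairD_apply hBa hBb (α := κa * (κa - c₅) * c₅)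
    (β := κa * (κa - c₅) * κb) rfl rfl
  have hρ : κa * (κa - c₅) ≠ 0 := mul_ne_zero h0 (sub_ne_zero.2 h5)
  have hα : ∀ n, (quadCoeff (κa * (κa - c₅) * c₅) (κa * (κa - c₅) * κb) n).1 ≠ 0 := by
    refine quadCoeff_fst_ne_zero fun i h1 => ?_
    -- Here β + iα/2 = κa(κa - c₅)(κb + i c₅/2).
    convert mul_ne_zero hρ (hi i h1) using 1
    ring
  generalize κa * (κa - c₅) * c₅ = α at hA hα
  generalize κa * (κa - c₅) * κb = β at hA hα
  obtain ⟨K, hK⟩ := exists_nat_forall_lt F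
  -- Taking K + 1 instead of K keeps n + ε positive, so u^a_0 is never among the moved variables.
  obtain ⟨n, hn⟩ : ∃ n, n = K + 1 := ⟨_, rfl⟩
  have hΩ := h.coordOpen
  have hε : ε ≤ 1 := by have := h.add_eq_one; omega
  obtain ⟨y, ⟨u', hu'y, hu'⟩, hy⟩ : ∃ y, (∃ w : phaseSpace 1 0 T,
      w.1 (b, ((n + 1 : ℕ) : ℤ)) = y ∧ ∀ k ≠ ((b, ((n + 1 : ℕ) : ℤ)) : Var 1 0), w.1 k = u.1 k) ∧
      y ≠ u.1 (b, ((n + 1 : ℕ) : ℤ)) :=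
    (((hΩ.eventually_exists u (b, ((n + 1 : ℕ) : ℤ))).filter_mono nhdsWithin_le_nhds).and
      (eventually_mem_nhdsWithin (a := u.1 (b, ((n + 1 : ℕ) : ℤ)))
        (s := {u.1 (b, ((n + 1 : ℕ) : ℤ))}ᶜ))).exists
  have hu'a : ∀ k : ℕ, u'.1 (a, (k : ℤ)) = u.1 (a, (k : ℤ)) := fun k => hu' _ (by simp [h.ne])
  -- The component k = n + 4 lies beyond n + 1 + ε, so p, q and the fixed value r belong to three
  -- different variables, and the sum over l < k contains l = n and l = n + 1.
  refine eq_zero_of_sum_quadForm_eq_zero hα (e := cv T a 0 u) (r := xv T a (n + 1 + ε) u)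
    (p₀ := cv T a (n + ε) u) (q₀ := cv T a (n + 4) u) ?_
  have hp' := hΩ.eventually_exists u' (a, ((n + ε : ℕ) : ℤ))
  rw [hu'a] at hp'
  filter_upwards [hΩ.eventually_exists u (a, ((n + ε : ℕ) : ℤ)), hp'] with p ⟨w, hwp, hw⟩
    ⟨w', hw'p, hw'⟩
  have hne4 : ((a, ((n + 4 : ℕ) : ℤ)) : Var 1 0) ≠ (a, ((n + ε : ℕ) : ℤ)) := by
    simp only [ne_eq, Prod.mk.injEq, true_and, Nat.cast_inj]
    omega
  have hq := hΩ.eventually_exists w (a, ((n + 4 : ℕ) : ℤ))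
  have hq' := hΩ.eventually_exists w' (a, ((n + 4 : ℕ) : ℤ))
  rw [hw _ hne4] at hq
  rw [hw' _ hne4, hu'a] at hq'
  filter_upwards [hq, hq'] with q ⟨z, hzq, hz⟩ ⟨z', hz'q, hz'⟩
  have hza : ∀ k : ℕ, k ≠ n + ε → k ≠ n + 4 → cv T a k z = cv T a k u := by
    intro k h1 h2
    have e1 := hz (a, (k : ℤ)) (by
      simp only [ne_eq, Prod.mk.injEq, true_and, Nat.cast_inj]; exact h2)
    have e2 := hw (a, (k : ℤ)) (by
      simp only [ne_eq, Prod.mk.injEq, true_and, Nat.cast_inj]; exact h1)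
    exact e1.trans e2
  have hzp : cv T a (n + ε) z = p := (hz _ hne4.symm).trans hwp
  have hz'p : cv T a (n + ε) z' = p := (hz' _ hne4.symm).trans hw'p
  have hza' : ∀ k : ℕ, cv T a k z' = cv T a k z := by
    intro k
    by_cases h1 : k = n + ε
    · rw [h1, hzp, hz'p]
    by_cases h2 : k = n + 4
    · rw [h2]; exact hz'q.trans hzq.symm
    rw [hza k h1 h2]
    have e1 := hz' (a, (k : ℤ)) (by
      simp only [ne_eq, Prod.mk.injEq, true_and, Nat.cast_inj]; exact h2)
    have e2 := hw' (a, (k : ℤ)) (by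
      simp only [ne_eq, Prod.mk.injEq, true_and, Nat.cast_inj]; exact h1)
    exact (e1.trans e2).trans (hu'a k)
  have hzb : ∀ k : ℕ, cv T b k z = cv T b k u := fun k =>
    (hz (b, (k : ℤ)) (by simp [h.ne.symm])).trans (hw _ (by simp [h.ne.symm]))
  have hzb' : ∀ k : ℕ, k ≠ n + 1 → cv T b k z' = cv T b k z := by
    intro k hk
    rw [hzb]
    exact ((hz' (b, (k : ℤ)) (by simp [h.ne.symm])).trans (hw' _ (by simp [h.ne.symm]))).trans
      (hu' _ (by simp only [ne_eq, Prod.mk.injEq, true_and, Nat.cast_inj]; exact hk))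
  have hzby : cv T b (n + 1) z' = y :=
    ((hz' _ (by simp [h.ne.symm])).trans (hw' _ (by simp [h.ne.symm]))).trans hu'y
  have hFz : ∀ i ∈ F, z.1 i = u.1 i ∧ z'.1 i = u.1 i := by
    intro i hi
    have hlt := hK i hi
    have n1 : i ≠ (a, ((n + 4 : ℕ) : ℤ)) := by rintro rfl; push_cast at hlt; omega
    have n2 : i ≠ (a, ((n + ε : ℕ) : ℤ)) := by rintro rfl; push_cast at hlt; omega
    have n3 : i ≠ (b, ((n + 1 : ℕ) : ℤ)) := by rintro rfl; push_cast at hlt; omega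
    exact ⟨(hz i n1).trans (hw i n2), ((hz' i n1).trans (hw' i n2)).trans (hu' i n3)⟩
  have r1 := hrel z (fun i hi => (hFz i hi).1) (a, ((n + 4 : ℕ) : ℤ))
  have r2 := hrel z' (fun i hi => (hFz i hi).2) (a, ((n + 4 : ℕ) : ℤ))
  have hxz' : ∀ k, xv T a k z' = xv T a k z := fun k => by rw [xv, xv, hza', hza']
  -- z and z' differ only in u^b_{n+1}, which enters the differences n and n + 1 with opposite
  -- signs; everything else cancels.
  have key : ∀ s, adIter (pairD Y c₅ b) Y (s + 1) (a, ((n + 4 : ℕ) : ℤ)) z -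
      adIter (pairD Y c₅ b) Y (s + 1) (a, ((n + 4 : ℕ) : ℤ)) z' =
      (κa * (cv T b (n + 1) u - y)) * (quadForm α β s (p - cv T a 0 u) (q - cv T a 0 u) -
        quadForm α β s (xv T a (n + 1 + ε) u) (q - cv T a 0 u)) := by
    intro s
    have z0 : cv T a 0 z = cv T a 0 u := hza 0 (by omega) (by omega)
    have x1 : xv T a (n + ε) z = p - cv T a 0 u := by rw [xv, hzp, z0]
    have x2 : xv T a (n + 4) z = q - cv T a 0 u := by rw [xv, z0]; exact congrArg (· - _) hzq
    have x3 : xv T a (n + 1 + ε) z = xv T a (n + 1 + ε) u := by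
      rw [xv, z0, hza _ (by omega) (by omega)]; rfl
    have hsum : ∑ l ∈ Finset.range n,
        dv T b l z' * quadForm α β s (xv T a (l + ε) z) (xv T a (n + 4) z) =
        ∑ l ∈ Finset.range n,
        dv T b l z * quadForm α β s (xv T a (l + ε) z) (xv T a (n + 4) z) := by
      refine Finset.sum_congr rfl fun l hl => ?_
      have := Finset.mem_range.1 hl
      rw [dv, dv, hzb' _ (by omega), hzb' _ (by omega)]
    simp only [hA, hxz', hza', hzb' 0 (by omega), Finset.sum_range_succ _ (n + 3),
      Finset.sum_range_succ _ (n + 2), Finset.sum_range_succ _ (n + 1),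
      Finset.sum_range_succ _ n, hsum, ← x1, ← x2, ← x3]
    simp only [dv, hzb' n (by omega), hzb' (n + 2) (by omega), hzb' (n + 3) (by omega),
      hzb' (n + 3 + 1) (by omega), hzby, ← hzb (n + 1), add_assoc, Nat.reduceAdd]
    ring
  have hsub := sub_eq_zero.2 (r1.trans r2.symm)
  rw [← Finset.sum_sub_distrib] at hsub
  simp only [← mul_sub, key] at hsub
  have hc : κa * (cv T b (n + 1) u - y) ≠ 0 := mul_ne_zero h0 (sub_ne_zero.2 hy.symm)
  refine mul_left_cancel₀ hc ?_
  rw [mul_zero, ← hsub, Finset.mul_sum]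
  exact Finset.sum_congr rfl fun s _ => by ring

end Integrality

/-! ### The system with two components -/

section Instances

/-- The lower component of the reduced system with `N₁ = 1`, `N₂ = 0`. -/
def comp₀ : Comp := ⟨0, by constructor <;> norm_num⟩

/-- The upper component of the reduced system with `N₁ = 1`, `N₂ = 0`. -/
def comp₁ : Comp := ⟨1, by constructor <;> norm_num⟩

variable {T : Set ℂ} {A : Fin 8 → ℂ → ℂ} {c₅ c₇ : ℂ}

lemma fieldY_apply_nat (j : Comp) (k : ℕ) (u : phaseSpace 1 0 T) :
    fieldY 1 0 T A (j, (k : ℤ)) u = ∑ m ∈ Finset.range k, reducedRhs 1 0 A u.1 j m := by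
  have h1 : Finset.Ico (k : ℤ) 0 = ∅ := Finset.Ico_eq_empty (by omega)
  rw [fieldY]
  simp only [h1, Finset.sum_empty, sub_zero]
  symm
  refine Finset.sum_nbij' (fun m : ℕ => (m : ℤ)) Int.toNat ?_ ?_ ?_ ?_ ?_ <;>
    simp +contextual

lemma cutoff_coe (u : Var 1 0 → ℂ) (j : Comp) (k : ℤ) : cutoff 1 0 u j k = u (j, k) :=
  dif_pos j.2

lemma reducedRhs_comp₀ (u : Var 1 0 → ℂ) (k : ℤ) : reducedRhs 1 0 A u comp₀ k =
    rhs A (u (comp₁, k)) (u (comp₀, k)) (u (comp₀, k + 1)) 0 := by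
  have h1 : (comp₀ : ℤ) + 1 = comp₁ := rfl
  have h2 : cutoff 1 0 u ((comp₀ : ℤ) - 1) (k + 1) = 0 := dif_neg (by simp [comp₀])
  rw [reducedRhs, h1, h2, cutoff_coe, cutoff_coe, cutoff_coe]

lemma reducedRhs_comp₁ (u : Var 1 0 → ℂ) (k : ℤ) : reducedRhs 1 0 A u comp₁ k =
    rhs A 0 (u (comp₁, k)) (u (comp₁, k + 1)) (u (comp₀, k + 1)) := by
  have h1 : (comp₁ : ℤ) - 1 = comp₀ := rfl
  have h2 : cutoff 1 0 u ((comp₁ : ℤ) + 1) k = 0 := dif_neg (by simp [comp₁])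
  rw [reducedRhs, h1, h2, cutoff_coe, cutoff_coe, cutoff_coe]

/-- The terms with A₅ and A₇ combine to c₅/2 (b² - c²) + c₇(b - c). The lower component sees its
neighbour at the same place and the upper one at the next place, hence the shifts 0 and 1. -/
lemma isPair_fieldY (hT : IsOpen T) (h4 : AnalyticOnNhd ℂ (A 4) T)
    (h6 : AnalyticOnNhd ℂ (A 6) T)
    (h0 : ∀ τ ∈ T, A 0 τ = 0 ∧ A 1 τ = 0 ∧ A 2 τ = 0 ∧ A 3 τ = 0)
    (h5 : ∀ τ ∈ T, A 5 τ = c₅ * τ) (h7 : ∀ τ ∈ T, A 7 τ = -(c₅ / 2) * τ ^ 2 + c₇ * τ) :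
    IsPair T (fieldY 1 0 T A) c₅ c₇ comp₀ comp₁ (A 4) (A 6) 1 0 := by
  have hrhs : ∀ a b c d, b - c ∈ T → rhs A a b c d = c₅ / 2 * (b ^ 2 - c ^ 2) + c₇ * (b - c)
      + A 4 (b - c) * a + A 6 (b - c) * d := by
    intro a b c d hbc
    obtain ⟨a0, a1, a2, a3⟩ := h0 _ hbc
    rw [rhs, a0, a1, a2, a3, h5 _ hbc, h7 _ hbc]
    ring
  refine ⟨hT, fun h => ?_, rfl, h4, h6, fun k => ?_, fun k => ?_⟩
  · have : (comp₀ : ℤ) = comp₁ := congrArg Subtype.val h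
    simp [comp₀, comp₁] at this
  · ext u
    rw [fieldY_apply_nat]
    refine Finset.sum_congr rfl fun m _ => ?_
    rw [reducedRhs_comp₀, hrhs _ _ _ _ (u.2 comp₀ m)]
    simp [pairRhs, dv, cv]
  · ext u
    rw [fieldY_apply_nat]
    refine Finset.sum_congr rfl fun m _ => ?_
    rw [reducedRhs_comp₁, hrhs _ _ _ _ (u.2 comp₁ m)]
    simp [pairRhs, dv, cv]

lemma eqOn_of_isOpen (hTc : IsConnected T) {f g : ℂ → ℂ} (hf : AnalyticOnNhd ℂ f T)
    (hg : AnalyticOnNhd ℂ g T) {V : Set ℂ} (hV : IsOpen V) (hVne : V.Nonempty) (hVT : V ⊆ T)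
    (h : ∀ τ ∈ V, f τ = g τ) : ∀ τ ∈ T, f τ = g τ := by
  obtain ⟨v, hv⟩ := hVne
  exact hf.eqOn_of_preconnected_of_eventuallyEq hg hTc.isPreconnected (hVT hv)
    (by filter_upwards [hV.mem_nhds hv] with τ hτ using h τ hτ)

end Instances

/-! ### The point change -/

section Change

/-- A linear recurrence with constant right-hand side: a constant, linear or quadratic solution
exists according as 1 is no root, a simple root or a double root of C₄x² + 2x + C₆. -/
lemma exists_shift (C₄ C₆ c₇ : ℂ) :
    ∃ s : ℤ → ℂ, ∀ j, 2 * s j + C₄ * s (j + 1) + C₆ * s (j - 1) = c₇ := by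
  by_cases h1 : 2 + C₄ + C₆ = 0
  · by_cases h2 : C₄ = C₆
    · refine ⟨fun j => -(c₇ / 2) * (j : ℂ) ^ 2, fun j => ?_⟩
      have h3 : C₆ = -1 := by linear_combination h1 / 2 - h2 / 2
      rw [h2, h3]
      push_cast
      ring
    · have h3 : C₄ - C₆ ≠ 0 := sub_ne_zero.2 h2
      refine ⟨fun j => c₇ / (C₄ - C₆) * (j : ℂ), fun j => ?_⟩
      push_cast
      field_simp
      linear_combination (c₇ * (j : ℂ)) * h1
  · refine ⟨fun _ => c₇ / (2 + C₄ + C₆), fun j => ?_⟩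
    field_simp

/-- The affine point change `u^j_n ↦ r u^j_n + s_j`. -/
def affinePointChange (r : ℂ) (hr : r ≠ 0) (s : ℤ → ℂ) : PointChange where
  map j _ :=
    { toFun := fun z => r * z + s j
      invFun := fun z => (z - s j) / r
      left_inv := fun z => by field_simp; ring
      right_inv := fun z => by field_simp; ring }
  differentiable_map j _ := by
    change Differentiable ℂ fun z => r * z + s j
    fun_prop
  differentiable_symm j _ := by
    change Differentiable ℂ fun z => (z - s j) / r
    fun_prop

/-- Scaling by c₅/2 normalizes the quadratic term, and shifts depending on j absorb c₇. -/
lemma exists_brings {T : Set ℂ} {A : Fin 8 → ℂ → ℂ} {c₅ c₇ c₄₀ c₆₀ : ℂ} (hc₅ : c₅ ≠ 0)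
    (h0 : ∀ τ ∈ T, A 0 τ = 0 ∧ A 1 τ = 0 ∧ A 2 τ = 0 ∧ A 3 τ = 0)
    (h4 : ∀ τ ∈ T, A 4 τ = c₄₀ * τ) (h6 : ∀ τ ∈ T, A 6 τ = c₆₀ * τ)
    (h5 : ∀ τ ∈ T, A 5 τ = c₅ * τ) (h7 : ∀ τ ∈ T, A 7 τ = -(c₅ / 2) * τ ^ 2 + c₇ * τ) :
    ∃ φ : PointChange, φ.Brings T (rhs A) (fun a b c d =>
      (b - c) * (b + c + 2 * c₄₀ / c₅ * a + 2 * c₆₀ / c₅ * d)) := by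
  obtain ⟨s, hs⟩ := exists_shift (2 * c₄₀ / c₅) (2 * c₆₀ / c₅) c₇
  have hr : c₅ / 2 ≠ 0 := div_ne_zero hc₅ two_ne_zero
  refine ⟨affinePointChange (c₅ / 2) hr s, ?_⟩
  intro j n a b c d p q hbc
  have hd : ∀ j n z, deriv ((affinePointChange (c₅ / 2) hr s).map j n) z = c₅ / 2 := by
    intro j n z
    change deriv (fun z => c₅ / 2 * z + s j) z = c₅ / 2
    simp
  have hm : ∀ j n z, (affinePointChange (c₅ / 2) hr s).map j n z = c₅ / 2 * z + s j :=
    fun _ _ _ => rfl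
  obtain ⟨a0, a1, a2, a3⟩ := h0 _ hbc
  simp only [hd, hm]
  rw [← mul_right_inj' hr]
  have e : c₅ / 2 * (p + rhs A a b c d) = c₅ / 2 * p +
      (c₅ / 2 * b + s j - (c₅ / 2 * c + s j)) * (c₅ / 2 * b + s j + (c₅ / 2 * c + s j)
        + 2 * c₄₀ / c₅ * (c₅ / 2 * a + s (j + 1)) + 2 * c₆₀ / c₅ * (c₅ / 2 * d + s (j - 1))) := by
    have hs' := hs j
    have e4 : 2 * c₄₀ / c₅ * (c₅ / 2 * a) = c₄₀ * a := by field_simp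
    have e6 : 2 * c₆₀ / c₅ * (c₅ / 2 * d) = c₆₀ * d := by field_simp
    rw [mul_add (2 * c₄₀ / c₅), mul_add (2 * c₆₀ / c₅), e4, e6]
    simp only [rhs, a0, a1, a2, a3, h4 _ hbc, h5 _ hbc, h6 _ hbc, h7 _ hbc]
    linear_combination -(c₅ / 2) * (b - c) * hs'
  rw [e]

end Change

end Chain

end

/-! ### The classification -/

theorem mainTheorem2
    (T : Set ℂ) (hT : IsOpen T) (hTc : IsConnected T)
    (A : Fin 8 → ℂ → ℂ) (hA : ∀ i, AnalyticOnNhd ℂ (A i) T)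
    (hnd : Chain.Nondegenerate T A)
    (hfin : Chain.FiniteXAlgebras T A)
    (c₄₀ c₄₁ c₄₂ c₆₀ c₆₁ c₆₂ c₅ c₇ : ℂ)
    (hclass : Chain.IsClassOne T A c₄₀ c₄₁ c₄₂ c₆₀ c₆₁ c₆₂ c₅ c₇) :
    ((c₅ - c₄₀) * (c₅ - c₆₀) ≠ 0 →
      ∃ M M' : ℕ, 1 ≤ M ∧ 1 ≤ M' ∧ ∃ φ : Chain.PointChange,
        φ.Brings T (Chain.rhs A)
          (fun a b c d => (b - c) * (b + c - (M : ℂ) * a - (M' : ℂ) * d))) ∧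
    ((c₅ - c₄₀) * (c₅ - c₆₀) = 0 →
      c₅ ≠ 0 ∧ ∃ C₄ C₆ : ℂ, C₄ = 2 * c₄₀ / c₅ ∧ C₆ = 2 * c₆₀ / c₅ ∧ (C₄ = 2 ∨ C₆ = 2) ∧
        ∃ φ : Chain.PointChange,
          φ.Brings T (Chain.rhs A)
            (fun a b c d => (b - c) * (b + c + C₄ * a + C₆ * d))) := by
  obtain ⟨V, ℓ, hVT, hV, hVne, hℓc, hform⟩ := hclass
  have hext := fun {f g : ℂ → ℂ} (hf : AnalyticOnNhd ℂ f T) (hg : AnalyticOnNhd ℂ g T) =>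
    Chain.eqOn_of_isOpen hTc hf hg hV hVne hVT
  have hz : AnalyticOnNhd ℂ (fun _ : ℂ => (0 : ℂ)) T := analyticOnNhd_const
  have hlin : ∀ r : ℂ, AnalyticOnNhd ℂ (fun τ : ℂ => r * τ) T := fun r =>
    analyticOnNhd_const.mul analyticOnNhd_id
  have h0 : ∀ τ ∈ T, A 0 τ = 0 ∧ A 1 τ = 0 ∧ A 2 τ = 0 ∧ A 3 τ = 0 := fun τ hτ =>
    ⟨hext (hA 0) hz (fun τ hτ => (hform τ hτ).2.1) τ hτ,
      hext (hA 1) hz (fun τ hτ => (hform τ hτ).2.2.1) τ hτ,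
      hext (hA 2) hz (fun τ hτ => (hform τ hτ).2.2.2.1) τ hτ,
      hext (hA 3) hz (fun τ hτ => (hform τ hτ).2.2.2.2.1) τ hτ⟩
  have h5 : ∀ τ ∈ T, A 5 τ = c₅ * τ :=
    hext (hA 5) (hlin c₅) fun τ hτ => (hform τ hτ).2.2.2.2.2.2.1
  have h7 : ∀ τ ∈ T, A 7 τ = -(c₅ / 2) * τ ^ 2 + c₇ * τ :=
    hext (hA 7) ((analyticOnNhd_const.mul (analyticOnNhd_id.pow 2)).add (hlin c₇))
      fun τ hτ => (hform τ hτ).2.2.2.2.2.2.2.2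
  have hne4 : ∃ v ∈ V, A 4 v ≠ 0 := by
    by_contra! hcon
    have h4 := hext (hA 4) hz hcon
    obtain ⟨a, b, c, d, hbc, hder⟩ := hnd.1
    obtain ⟨a0, a1, a2, a3⟩ := h0 _ hbc
    simp [Chain.rhs, a0, a2, a3, h4 _ hbc] at hder
  have hne6 : ∃ v ∈ V, A 6 v ≠ 0 := by
    by_contra! hcon
    have h6 := hext (hA 6) hz hcon
    obtain ⟨a, b, c, d, hbc, hder⟩ := hnd.2
    obtain ⟨a0, a1, a2, a3⟩ := h0 _ hbc
    simp [Chain.rhs, a0, a1, a3, h6 _ hbc] at hder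
  have hpair := Chain.isPair_fieldY hT (hA 4) (hA 6) h0 h5 h7
  have hYS := Set.mem_insert (Chain.fieldY 1 0 T A) (Set.range (Chain.fieldX 1 0 T))
  have hXS : ∀ j, Chain.fieldX 1 0 T j ∈ insert (Chain.fieldY 1 0 T A) (Set.range (Chain.fieldX 1 0 T)) :=
    fun j => Set.mem_insert_of_mem _ ⟨j, rfl⟩
  have hlog : ∀ r₀ r₁ r₂ : ℂ, (Polynomial.C r₀ + Polynomial.C r₁ * Polynomial.X +
      Polynomial.C r₂ * Polynomial.X ^ 2).natDegree = 0 → r₁ = 0 ∧ r₂ = 0 := by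
    intro r₀ r₁ r₂ hdeg
    have hc := fun n (hn : 0 < n) => Polynomial.coeff_eq_zero_of_natDegree_lt (hdeg.trans_lt hn)
    have hc1 := hc 1 one_pos
    have hc2 := hc 2 two_pos
    simp [Polynomial.coeff_C, Polynomial.coeff_X_pow] at hc1 hc2
    exact ⟨hc1, hc2⟩
  obtain ⟨v₆, hv₆, hA6⟩ := hne6
  obtain ⟨v₄, hv₄, hA4⟩ := hne4
  -- Crosswise: excluding logarithms in A₄ uses a point where A₆ ≠ 0, and conversely.
  obtain ⟨rfl, rfl⟩ := hlog c₄₀ c₄₁ c₄₂ (hpair.natDegree_eq_zero hYS (hXS _) (hfin 1 0) hV hVT hℓc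
    (fun τ hτ => (hform τ hτ).1) (fun τ hτ => by
      rw [(hform τ hτ).2.2.2.2.2.1]; simp; ring) hv₆ hA6)
  obtain ⟨rfl, rfl⟩ := hlog c₆₀ c₆₁ c₆₂ (hpair.symm.natDegree_eq_zero hYS (hXS _) (hfin 1 0) hV
    hVT hℓc (fun τ hτ => (hform τ hτ).1) (fun τ hτ => by
      rw [(hform τ hτ).2.2.2.2.2.2.2.1]; simp; ring) hv₄ hA4)
  have h4 : ∀ τ ∈ T, A 4 τ = c₄₀ * τ := hext (hA 4) (hlin c₄₀) fun τ hτ => by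
    rw [(hform τ hτ).2.2.2.2.2.1]; ring
  have h6 : ∀ τ ∈ T, A 6 τ = c₆₀ * τ := hext (hA 6) (hlin c₆₀) fun τ hτ => by
    rw [(hform τ hτ).2.2.2.2.2.2.2.1]; ring
  have hc4 : c₄₀ ≠ 0 := by
    rintro rfl
    exact hA4 (by rw [h4 _ (hVT hv₄), zero_mul])
  have hc6 : c₆₀ ≠ 0 := by
    rintro rfl
    exact hA6 (by rw [h6 _ (hVT hv₆), zero_mul])
  constructor
  · intro hne
    have hTne := hTc.nonempty
    -- Again crosswise: c₄₀ ≠ c₅ determines c₆₀, and c₆₀ ≠ c₅ determines c₄₀.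
    obtain ⟨M', hM', e6⟩ := hpair.exists_nat h4 h6 hTne hYS (hXS _) (hfin 1 0) hc4
      fun e => hne (by rw [e]; ring)
    obtain ⟨M, hM, e4⟩ := hpair.symm.exists_nat h6 h4 hTne hYS (hXS _) (hfin 1 0) hc6
      fun e => hne (by rw [e]; ring)
    have hc5 : c₅ ≠ 0 := by
      rintro rfl
      exact hc4 (by simpa using e4)
    refine ⟨M, M', hM, hM', ?_⟩
    obtain ⟨φ, hφ⟩ := Chain.exists_brings hc5 h0 h4 h6 h5 h7
    refine ⟨φ, ?_⟩
    convert hφ using 6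
    have f4 : 2 * c₄₀ / c₅ = -M := by
      field_simp
      linear_combination 2 * e4
    have f6 : 2 * c₆₀ / c₅ = -M' := by
      field_simp
      linear_combination 2 * e6
    rw [f4, f6]
    ring
  · intro heq
    have hc5 : c₅ ≠ 0 := by
      rintro rfl
      simp [hc4, hc6] at heq
    refine ⟨hc5, _, _, rfl, rfl, ?_, Chain.exists_brings hc5 h0 h4 h6 h5 h7⟩
    rcases mul_eq_zero.1 heq with e | e
    · left
      rw [← sub_eq_zero.1 e]
      field_simp
    · right
      rw [← sub_eq_zero.1 e]
      field_simp
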